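/- **Setting.** Let $X=\mathbb R^d$, $S=\mathbb R^m$ with Euclidean norms. A marked configuration is a set $\widehat\gamma\subset X\times S$ containing at most one point $(x,\sigma_x)$ over each $x\in X$ and whose set of positions $\gamma$ is locally finite; $\Gamma(X,S)$ is the space of marked configurations, with the Borel $\sigma$-algebra of the weakest topology making all maps $\widehat\gamma\mapsto\sum_{x\in\gamma}f(x,\sigma_x)$ continuous, $f$ bounded continuous with support in $\Lambda\times S$ for some compact $\Lambda\subset X$. Write $\widehat\gamma_\Delta=\{(x,\sigma_x)\in\widehat\gamma: x\in\Delta\}$ and $N$ for the number of points. For $k\in\mathbb Z^d$ let $Q_k=\prod_i[k^{(i)}-\tfrac12,k^{(i)}+\tfrac12)$, $\gamma_k=\gamma_{Q_k}$, $\widehat\gamma_k=\widehat\gamma_{Q_k}$, and $Q_{\mathcal K}=\bigcup_{k\in\mathcal K}Q_k$ for finite $\mathcal K\subset\mathbb Z^d$. Let $\Phi:X\times X\to\mathbb R\cup\{+\infty\}$, $J:X\times X\to\mathbb R$, $W:S\times S\to\mathbb R$ be symmetric and measurable, $V:S\to\mathbb R$ measurable, $J$ bounded, and assume: 1. there is $R>0$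 with $\Phi(x,y)=0$ and $J_{xy}=0$ whenever $|x-y|\ge R$; 2. there are $P>2$, $A>0$, $B\ge 0$ such that $H(\gamma):=\sum_{\{x,y\}\subset\gamma}\Phi(x,y)\ge A\sum_{k\in\mathbb Z^d}N(\gamma_k)^P-B\,N(\gamma)$ for every finite $\gamma\subset X$; 3. there are $r>0$ and $C_W\in\mathbb R$ with $|W(u,v)|\le|u|^r+|v|^r+C_W$ for all $u,v\in S$; 4. there are $q_V\in\mathbb N$, $a_V>0$, $b_V\ge0$ with $V(s)\ge a_V|s|^{q_V}-b_V$ for all $s\in S$; 5. $(P-2)(q_V/r-1)>1$. Fix $p,q\in\mathbb N$ with $2<p<P$, $q<q_V$ and $(p-2)(q/r-1)\ge1$, and put $F(\widehat\gamma)=N(\gamma)^p+\sum_{x\in\gamma}|\sigma_x|^q$ for finite $\widehat\gamma$. A configuration $\widehat\zeta\in\Gamma(X,S)$ is tempered if $\sup_{k\in\mathbb Z^d}e^{-\alpha|k|}F(\widehat\zeta_k)<\infty$ for every $\alpha>0$. Fix an activity $z>0$ and put $g(ds)=e^{-V(s)}ds$. For bounded Borel $\Delta\subset X$ let $\widehat\lambda_\Delta$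 be the marked Lebesgue–Poisson measure on configurations in $\Delta\times S$: on $n$-point configurations it is $z^n/n!$ times the image of $(dx\otimes g)^{\otimes n}$ on $(\Delta\times S)^n$, tuples with coinciding positions removed, under $(x_i,s_i)_{i\le n}\mapsto\{(x_i,s_i):i\le n\}$. For $\widehat\eta=(\eta,\xi)\in\Gamma(X,S)$ let $$\widehat H_\Delta(\widehat\gamma_\Delta|\widehat\eta)=\sum_{\{x,y\}\subset\gamma_\Delta}\big(\Phi(x,y)+J_{xy}W(\sigma_x,\sigma_y)\big)+\sum_{x\in\gamma_\Delta}\sum_{y\in\eta_{\Delta^c}}\big(\Phi(x,y)+J_{xy}W(\sigma_x,\xi_y)\big),$$ and let $\Pi_{\widehat\Delta}(\cdot|\widehat\eta)$ be the law of $\widehat\gamma_\Delta\cup\widehat\eta_{\Delta^c}$ when $\widehat\gamma_\Delta$ is distributed according to $Z_\Delta(\widehat\eta)^{-1}e^{-\beta\widehat H_\Delta(\widehat\gamma_\Delta|\widehat\eta)}\,\widehat\lambda_\Delta(d\widehat\gamma_\Delta)$, where $Z_\Delta(\widehat\eta)=\int e^{-\beta\widehat H_\Delta(\cdot|\widehat\eta)}\,d\widehat\lambda_\Delta$.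 **Theorem.** For every $\beta>0$ and every $a\in\mathbb R$ there is a constant $\Psi=\Psi(a)<\infty$ such that for every tempered $\widehat\zeta$ and every $k\in\mathbb Z^d$ $$\limsup_{\mathcal K\nearrow\mathbb Z^d}\int_{\Gamma(X,S)}\exp\{aF(\widehat\gamma_k)\}\;\Pi_{\widehat Q_{\mathcal K}}(d\widehat\gamma\,|\,\widehat\zeta)\le\Psi,$$ where the $\limsup$ is taken along the finite subsets $\mathcal K\subset\mathbb Z^d$ directed by inclusion. The constant $\Psi$ may depend on $\beta$, $z$ and the model, but not on $\widehat\zeta$ or $k$. -/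

import Mathlib

open MeasureTheory Filter
open scoped ENNReal NNReal

noncomputable section

namespace MarkedGibbs

/-- The position space `X = ℝ^d`; the spin space is `S = Pos m = ℝ^m`. -/
abbrev Pos (d : ℕ) : Type := EuclideanSpace ℝ (Fin d)

/-- The lattice point `k ∈ ℤ^d` viewed in `ℝ^d`. -/
def latticePoint {d : ℕ} (k : Fin d → ℤ) : Pos d := WithLp.toLp 2 (fun i => (k i : ℝ))

/-- The half-open unit cube `Q_k` centred at `k ∈ ℤ^d`. -/
def cube {d : ℕ} (k : Fin d → ℤ) : Set (Pos d) :=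
  {x | ∀ i, (k i : ℝ) - 1 / 2 ≤ x i ∧ x i < (k i : ℝ) + 1 / 2}

/-- The union `Q_𝒦` of the unit cubes indexed by a finite set `𝒦 ⊂ ℤ^d`. -/
def cubes {d : ℕ} (K : Finset (Fin d → ℤ)) : Set (Pos d) := ⋃ k ∈ K, cube k

/-! ### Marked configurations -/

/-- The marked configuration space `Γ(X, S)`: sets of pairs (position, spin) in which no position
occurs twice and whose set of positions is locally finite. -/
@[ext]
structure MarkedConf (d m : ℕ) where
  carrier : Set (Pos d × Pos m)
  injOn : Set.InjOn Prod.fst carrier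
  finite_of_isCompact : ∀ Λ : Set (Pos d), IsCompact Λ → {p ∈ carrier | p.1 ∈ Λ}.Finite

namespace MarkedConf

variable {d m : ℕ}

/-- The configuration of positions `γ = p_X(γ̂)`. -/
def positions (γ : MarkedConf d m) : Set (Pos d) := Prod.fst '' γ.carrier

/-- The restriction `γ̂_Δ` of a marked configuration to the particles with position in `Δ`. -/
def restrict (Δ : Set (Pos d)) (γ : MarkedConf d m) : MarkedConf d m where
  carrier := {p ∈ γ.carrier | p.1 ∈ Δ}
  injOn := γ.injOn.mono fun _ hp => hp.1
  finite_of_isCompact Λ hΛ := (γ.finite_of_isCompact Λ hΛ).subset fun _ hp => ⟨hp.1.1, hp.2⟩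

/-- The configuration `γ̂_Δ ∪ η̂_{Δᶜ}`. -/
def glue (Δ : Set (Pos d)) (η γ : MarkedConf d m) : MarkedConf d m where
  carrier := (γ.restrict Δ).carrier ∪ (η.restrict Δᶜ).carrier
  injOn := by
    rintro p (hp | hp) q (hq | hq) h
    · exact γ.injOn hp.1 hq.1 h
    · exact absurd (h ▸ hp.2) hq.2
    · exact absurd (h ▸ hq.2) hp.2
    · exact η.injOn hp.1 hq.1 h
  finite_of_isCompact Λ hΛ :=
    ((γ.finite_of_isCompact Λ hΛ).union (η.finite_of_isCompact Λ hΛ)).subset <| by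
      rintro p ⟨hp | hp, hΛ'⟩
      · exact Or.inl ⟨hp.1, hΛ'⟩
      · exact Or.inr ⟨hp.1, hΛ'⟩

/-- The pairing `⟨f, γ̂⟩ = ∑_{(x, σ_x) ∈ γ̂} f(x, σ_x)`. -/
def pairing (f : Pos d × Pos m → ℝ) (γ : MarkedConf d m) : ℝ := ∑ᶠ p ∈ γ.carrier, f p

/-- The bounded continuous functions on `X × S` with spatially compact support. -/
def IsTestFunction (f : Pos d × Pos m → ℝ) : Prop :=
  Continuous f ∧ (∃ C : ℝ, ∀ p, |f p| ≤ C) ∧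
    ∃ Λ : Set (Pos d), IsCompact Λ ∧ Function.support f ⊆ Λ ×ˢ Set.univ

/-- The `τ`-topology: the weakest topology making all `γ̂ ↦ ⟨f, γ̂⟩` continuous, where `f` is
bounded and continuous with spatially compact support. -/
instance : TopologicalSpace (MarkedConf d m) :=
  ⨅ f : {f : Pos d × Pos m → ℝ // IsTestFunction f},
    TopologicalSpace.induced (pairing f.1) inferInstance

/-- `Γ(X, S)` carries the Borel `σ`-algebra of the `τ`-topology. -/
instance : MeasurableSpace (MarkedConf d m) := borel _

instance : BorelSpace (MarkedConf d m) := ⟨rfl⟩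

open scoped Classical in
/-- The configuration `{(x_1, s_1), …, (x_n, s_n)}` of a tuple with pairwise distinct positions
(the empty configuration if two positions coincide). -/
def ofTuple {n : ℕ} (w : Fin n → Pos d × Pos m) : MarkedConf d m :=
  if h : Function.Injective (fun i => (w i).1) then
    { carrier := Set.range w
      injOn := by
        rintro _ ⟨i, rfl⟩ _ ⟨j, rfl⟩ hij
        exact congrArg w (h hij)
      finite_of_isCompact := fun _ _ => (Set.finite_range w).subset fun _ hp => hp.1 }
  else
    { carrier := ∅
      injOn := Set.injOn_empty _
      finite_of_isCompact := fun _ _ => Set.finite_empty.subset fun _ hp => hp.1 }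

/-- `F(γ̂) = N(γ)^p + ∑_{x ∈ γ} |σ_x|^q`, for finite `γ̂`. -/
def lyapunov (p q : ℕ) (γ : MarkedConf d m) : ℝ :=
  (γ.positions.ncard : ℝ) ^ p + ∑ᶠ u ∈ γ.carrier, ‖u.2‖ ^ q

/-- `F_α(γ̂) = sup_{k ∈ ℤ^d} e^{-α|k|} F(γ̂_k)`, with values in `[0, ∞]`. -/
def weightedSup (p q : ℕ) (α : ℝ) (γ : MarkedConf d m) : ℝ≥0∞ :=
  ⨆ k : Fin d → ℤ,
    ENNReal.ofReal (Real.exp (-α * ‖latticePoint k‖) * lyapunov p q (γ.restrict (cube k)))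

/-- The space `Γ^t(X, S)` of tempered configurations. -/
def tempered (d m p q : ℕ) : Set (MarkedConf d m) :=
  {γ | ∀ α : ℝ, 0 < α → weightedSup p q α γ < ∞}

end MarkedConf

/-! ### The interaction -/

/-- The data of the model: the positional pair potential `Φ`, the coupling `J`, the spin-spin
interaction `W`, and the single-spin potential `V`. -/
structure Potentials (d m : ℕ) where
  Φ : Pos d → Pos d → EReal
  J : Pos d → Pos d → ℝ
  W : Pos m → Pos m → ℝ
  V : Pos m → ℝ

namespace Potentials

variable {d m : ℕ}

/-- `H(γ) = ∑_{{x, y} ⊂ γ} Φ(x, y)` for finite `γ`, the sum over unordered pairs being half the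
sum over ordered pairs of distinct points (`Φ` is symmetric). -/
def posEnergy (U : Potentials d m) (γ : Set (Pos d)) : EReal :=
  ((1 / 2 : ℝ) : EReal) * ∑ᶠ x ∈ γ, ∑ᶠ y ∈ γ \ {x}, U.Φ x y

/-- `E_γ(σ) = ∑_{{x, y} ⊂ γ} J_{xy} W(σ_x, σ_y)` for finite `γ̂`. -/
def spinEnergy (U : Potentials d m) (γ : MarkedConf d m) : ℝ :=
  (1 / 2 : ℝ) * ∑ᶠ u ∈ γ.carrier, ∑ᶠ v ∈ γ.carrier \ {u}, U.J u.1 v.1 * U.W u.2 v.2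

/-- `H_Δ(γ_Δ | η) = H(γ_Δ) + ∑_{x ∈ γ_Δ} ∑_{y ∈ η_{Δᶜ}} Φ(x, y)`. -/
def condPosEnergy (U : Potentials d m) (Δ : Set (Pos d)) (η γ : MarkedConf d m) : EReal :=
  U.posEnergy (γ.restrict Δ).positions +
    ∑ᶠ x ∈ (γ.restrict Δ).positions, ∑ᶠ y ∈ (η.restrict Δᶜ).positions, U.Φ x y

/-- `E_{γ_Δ, η}(σ | ξ) = E_{γ_Δ}(σ) + ∑_{x ∈ γ_Δ} ∑_{y ∈ η_{Δᶜ}} J_{xy} W(σ_x, ξ_y)`. -/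
def condSpinEnergy (U : Potentials d m) (Δ : Set (Pos d)) (η γ : MarkedConf d m) : ℝ :=
  U.spinEnergy (γ.restrict Δ) +
    ∑ᶠ u ∈ (γ.restrict Δ).carrier, ∑ᶠ v ∈ (η.restrict Δᶜ).carrier, U.J u.1 v.1 * U.W u.2 v.2

/-- The relative local interaction energy `Ĥ_Δ(γ̂_Δ | η̂) ∈ ℝ ∪ {+∞}`. -/
def condEnergy (U : Potentials d m) (Δ : Set (Pos d)) (η γ : MarkedConf d m) : EReal :=
  U.condPosEnergy Δ η γ + (U.condSpinEnergy Δ η γ : EReal)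

/-- The Boltzmann factor `exp(-β Ĥ_Δ(γ̂_Δ | η̂))`. -/
def boltzmann (U : Potentials d m) (β : ℝ) (Δ : Set (Pos d)) (η γ : MarkedConf d m) : ℝ≥0∞ :=
  EReal.exp (-((β : EReal) * U.condEnergy Δ η γ))

/-- The single-spin measure `g(ds) = e^{-V(s)} ds`. -/
def spinMeasure (U : Potentials d m) : Measure (Pos m) :=
  volume.withDensity fun s => ENNReal.ofReal (Real.exp (-U.V s))

/-- The marked Lebesgue-Poisson measure `λ̂` on `Γ(Δ, S)`, viewed as a measure on `Γ(X, S)`, with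
activity `z`: on `n`-point configurations it is `z^n / n!` times the image of `(dx ⊗ g)^{⊗ n}` on
`(Δ × S)^n` without the tuples in which positions coincide. -/
def lebesguePoisson (U : Potentials d m) (z : ℝ) (Δ : Set (Pos d)) : Measure (MarkedConf d m) :=
  Measure.sum fun n : ℕ =>
    ENNReal.ofReal (z ^ n / n.factorial) •
      ((Measure.pi fun _ : Fin n => (volume.restrict Δ).prod U.spinMeasure).restrict
        {w | Function.Injective fun i => (w i).1}).map MarkedConf.ofTuple

/-- The partition function `Z_Δ(η̂)`. -/
def partition (U : Potentials d m) (z β : ℝ) (Δ : Set (Pos d)) (η : MarkedConf d m) : ℝ≥0∞ :=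
  ∫⁻ γ, U.boltzmann β Δ η γ ∂U.lebesguePoisson z Δ

/-- The local Gibbs state `μ_Δ^{η̂} = Z_Δ(η̂)⁻¹ exp(-β Ĥ_Δ(γ̂_Δ | η̂)) λ̂(dγ̂_Δ)`. -/
def localGibbs (U : Potentials d m) (z β : ℝ) (Δ : Set (Pos d)) (η : MarkedConf d m) :
    Measure (MarkedConf d m) :=
  (U.partition z β Δ η)⁻¹ • (U.lebesguePoisson z Δ).withDensity (U.boltzmann β Δ η)

/-- The specification kernel `Π_Δ(· | η̂)`: the law of `γ̂_Δ ∪ η̂_{Δᶜ}` under `μ_Δ^{η̂}`. -/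
def specification (U : Potentials d m) (z β : ℝ) (Δ : Set (Pos d)) (η : MarkedConf d m) :
    Measure (MarkedConf d m) :=
  (U.localGibbs z β Δ η).map (MarkedConf.glue Δ η)

/-- The standing assumptions on the potentials; `P`, `r`, `qV` are the exponents in the strong
superstability of `Φ`, the growth bound on `W`, and the lower bound on `V`. -/
structure Admissible (U : Potentials d m) (P r : ℝ) (qV : ℕ) : Prop where
  Φ_ne_bot : ∀ x y, U.Φ x y ≠ ⊥
  Φ_symm : ∀ x y, U.Φ x y = U.Φ y x
  J_symm : ∀ x y, U.J x y = U.J y x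
  W_symm : ∀ u v, U.W u v = U.W v u
  Φ_meas : Measurable (Function.uncurry U.Φ)
  J_meas : Measurable (Function.uncurry U.J)
  W_meas : Measurable (Function.uncurry U.W)
  V_meas : Measurable U.V
  J_bdd : ∃ C : ℝ, ∀ x y, |U.J x y| ≤ C
  finite_range : ∃ R : ℝ, 0 < R ∧ ∀ x y : Pos d, R ≤ ‖x - y‖ → U.Φ x y = 0 ∧ U.J x y = 0
  two_lt_P : 2 < P
  superstable : ∃ A B : ℝ, 0 < A ∧ 0 ≤ B ∧ ∀ γ : Set (Pos d), γ.Finite →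
    ((A * ∑ᶠ k : Fin d → ℤ, ((γ ∩ cube k).ncard : ℝ) ^ P - B * (γ.ncard : ℝ) : ℝ) : EReal)
      ≤ U.posEnergy γ
  r_pos : 0 < r
  W_bound : ∃ C : ℝ, ∀ u v, |U.W u v| ≤ ‖u‖ ^ r + ‖v‖ ^ r + C
  V_bound : ∃ a b : ℝ, 0 < a ∧ 0 ≤ b ∧ ∀ s, a * ‖s‖ ^ qV - b ≤ U.V s
  exponents : 1 < (P - 2) * ((qV : ℝ) / r - 1)

end Potentials

end MarkedGibbs

end

/-!
Uniform exponential moments for Gibbs states of marked particles with unbounded spins.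

The proof compares the exponential moment of `F` in one cube `k` with the moments in the
neighbouring cubes.  Emptying the cube changes the energy by the self-energy of its particles plus
their interaction with the surroundings (`condEnergy_eq_add_localEnergy`).  Strong superstability
makes the self-energy at least `A N ^ P` up to lower order terms; since the potentials have finite
range and the exponents satisfy `(p - 2) (q / r - 1) ≥ 1`, Young's inequality bounds every
interaction term by `C F(γ_k) + ε ∑ F(η_j)`, the sum running over the nearby cubes, with `ε` as
small as desired (`exists_localEnergy_ge`).  As `N ^ P` beats `N ^ p`, and `V` beats
`‖σ‖ ^ q` in the single-spin measure, the particles of the cube can be integrated out at the cost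
of a constant, because the Lebesgue--Poisson measure factorizes over disjoint regions
(`lintegral_prod_mul_restrict_compl_le`, `exists_lintegral_boltzmann_le`).

With `ε` chosen as a small multiple of `a`, Jensen's inequality turns this into a recursion for the
logarithms of the moments, `log M_k ≤ c + 1 / 2 * log M_j` for some nearby `j`
(`exists_expMoment_le`), with `M_j = exp (a F(ζ_j))` outside the volume.  In a finite volume all
moments are finite, by emptying the cubes one after the other
(`lintegral_exp_sum_lyapunov_lt_top`), so the recursion can be solved with the weights
`exp (-α |j - k|)` (`le_max_of_recursion`): either the bound `4 c` holds or the weighted boundary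
values dominate, and for a tempered `ζ` these are at most `1` once the volume is large.

The topology on configurations is a weak one, so measurability of the Boltzmann factor is obtained
from the measurability of its expression in the tuple of particles: the configuration space is
countably separated and the `n`-point configurations are a measurable image of a standard Borel
space, to which the Lusin--Souslin theorem applies (`TupleMeasurable.aemeasurable_map`).
-/

namespace MarkedGibbs

/-! ### Geometry of the cube partition -/

lemma abs_coord_le_norm {d : ℕ} (x : Pos d) (i : Fin d) : |x i| ≤ ‖x‖ := by
  simpa [Real.norm_eq_abs] using PiLp.norm_apply_le x i

lemma norm_le_sqrt_mul {d : ℕ} (x : Pos d) (c : ℝ) (hc : 0 ≤ c) (h : ∀ i, |x i| ≤ c) :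
    ‖x‖ ≤ √d * c := by
  rw [EuclideanSpace.norm_eq]
  have : ∑ i, ‖x i‖ ^ 2 ≤ d * c ^ 2 := by
    calc ∑ i, ‖x i‖ ^ 2 ≤ ∑ _i : Fin d, c ^ 2 :=
          Finset.sum_le_sum fun i _ => by
            rw [Real.norm_eq_abs]; exact pow_le_pow_left₀ (abs_nonneg _) (h i) 2
      _ = d * c ^ 2 := by simp
  calc √(∑ i, ‖x i‖ ^ 2) ≤ √(d * c ^ 2) := Real.sqrt_le_sqrt this
    _ = √d * c := by rw [Real.sqrt_mul (by positivity), Real.sqrt_sq hc]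

/-- The index of the unit cube that contains `x`. -/
noncomputable def cubeIndex {d : ℕ} (x : Pos d) : Fin d → ℤ := fun i => ⌊x i + 1 / 2⌋

lemma mem_cube_iff {d : ℕ} {x : Pos d} {k : Fin d → ℤ} : x ∈ cube k ↔ cubeIndex x = k := by
  simp only [cube, Set.mem_ofPred_eq, cubeIndex, funext_iff, Int.floor_eq_iff]
  refine forall_congr' fun i => and_congr ?_ ?_ <;> constructor <;> intro h <;> linarith

lemma mem_cubes_iff {d : ℕ} {x : Pos d} {K : Finset (Fin d → ℤ)} :
    x ∈ cubes K ↔ cubeIndex x ∈ K := by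
  simp [cubes, mem_cube_iff]

lemma cube_subset_cubes {d : ℕ} {k : Fin d → ℤ} {K : Finset (Fin d → ℤ)} (hk : k ∈ K) :
    cube k ⊆ cubes K := fun x hx => by
  rw [mem_cubes_iff]; rw [mem_cube_iff] at hx; rwa [hx]

lemma disjoint_cube_cubes {d : ℕ} {k : Fin d → ℤ} {K : Finset (Fin d → ℤ)} (hk : k ∉ K) :
    Disjoint (cube k) (cubes K) := by
  rw [Set.disjoint_left]
  intro x hx hx'
  rw [mem_cubes_iff] at hx'; rw [mem_cube_iff] at hx
  exact hk (hx ▸ hx')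

lemma disjoint_cube {d : ℕ} {j k : Fin d → ℤ} (h : j ≠ k) : Disjoint (cube j) (cube k) := by
  rw [Set.disjoint_left]
  intro x hx hx'
  rw [mem_cube_iff] at hx hx'
  exact h (hx.symm.trans hx')

lemma measurableSet_cube {d : ℕ} (k : Fin d → ℤ) : MeasurableSet (cube k) := by
  have : cube k = ⋂ i, {x : Pos d | (k i : ℝ) - 1 / 2 ≤ x i} ∩ {x | x i < (k i : ℝ) + 1 / 2} := by
    ext x; simp [cube]
  rw [this]
  refine MeasurableSet.iInter fun i => ?_
  exact (measurableSet_le (by fun_prop) (by fun_prop)).inter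
    (measurableSet_lt (by fun_prop) (by fun_prop))

lemma measurableSet_cubes {d : ℕ} (K : Finset (Fin d → ℤ)) : MeasurableSet (cubes K) :=
  Finset.measurableSet_biUnion _ fun k _ => measurableSet_cube k

lemma isBounded_cube {d : ℕ} (k : Fin d → ℤ) : Bornology.IsBounded (cube k) := by
  refine (Metric.isBounded_closedBall (x := latticePoint k) (r := √d * 1)).subset fun x hx => ?_
  rw [Metric.mem_closedBall, dist_eq_norm]
  refine norm_le_sqrt_mul _ 1 zero_le_one fun i => ?_
  have := hx i
  simp only [latticePoint, PiLp.sub_apply, abs_le]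
  constructor <;> linarith

lemma isBounded_cubes {d : ℕ} (K : Finset (Fin d → ℤ)) : Bornology.IsBounded (cubes K) :=
  (Bornology.isBounded_biUnion_finset K).2 fun k _ => isBounded_cube k

lemma volume_cube {d : ℕ} (k : Fin d → ℤ) : volume (cube k) = 1 := by
  have h : cube k = (@WithLp.ofLp 2 (Fin d → ℝ)) ⁻¹'
      (Set.univ.pi fun i => Set.Ico ((k i : ℝ) - 1 / 2) ((k i : ℝ) + 1 / 2)) := by
    ext x; simp [cube]
  rw [h, (PiLp.volume_preserving_ofLp (Fin d)).measure_preimage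
    (MeasurableSet.univ_pi fun i => measurableSet_Ico).nullMeasurableSet, volume_pi_pi]
  refine Finset.prod_eq_one fun i _ => ?_
  rw [Real.volume_Ico]; norm_num

/-- The box of lattice points at sup-distance at most `M` from `k`. -/
noncomputable def nearby {d : ℕ} (M : ℕ) (k : Fin d → ℤ) : Finset (Fin d → ℤ) :=
  Fintype.piFinset fun i => Finset.Icc (k i - M) (k i + M)

lemma mem_nearby {d M : ℕ} {k j : Fin d → ℤ} :
    j ∈ nearby M k ↔ ∀ i, k i - M ≤ j i ∧ j i ≤ k i + M := by
  simp [nearby]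

lemma self_mem_nearby {d : ℕ} (M : ℕ) (k : Fin d → ℤ) : k ∈ nearby M k :=
  mem_nearby.2 fun i => ⟨by omega, by omega⟩

lemma card_nearby {d : ℕ} (M : ℕ) (k : Fin d → ℤ) : (nearby M k).card = (2 * M + 1) ^ d := by
  rw [nearby, Fintype.card_piFinset]
  have : ∀ i, (Finset.Icc (k i - M) (k i + M)).card = 2 * M + 1 := fun i => by
    rw [Int.card_Icc]; omega
  simp [this]

lemma mem_nearby_of_norm_lt {d M : ℕ} {x y : Pos d} (h : ‖x - y‖ < M) :
    cubeIndex y ∈ nearby M (cubeIndex x) := by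
  rw [mem_nearby]
  intro i
  have h1 : |x i - y i| < M := lt_of_le_of_lt (abs_coord_le_norm (x - y) i) h
  rw [abs_lt] at h1
  have hx := Int.floor_le (x i + 1 / 2)
  have hx' := Int.lt_floor_add_one (x i + 1 / 2)
  have hy := Int.floor_le (y i + 1 / 2)
  have hy' := Int.lt_floor_add_one (y i + 1 / 2)
  simp only [cubeIndex]
  constructor
  · have : ((⌊x i + 1 / 2⌋ - M : ℤ) : ℝ) < (⌊y i + 1 / 2⌋ + 1 : ℤ) := by push_cast; linarith
    have := Int.cast_lt.1 this
    omega
  · have : ((⌊y i + 1 / 2⌋ : ℤ) : ℝ) < (⌊x i + 1 / 2⌋ + M + 1 : ℤ) := by push_cast; linarith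
    have := Int.cast_lt.1 this
    omega

lemma norm_latticePoint_sub_le {d M : ℕ} {k j : Fin d → ℤ} (h : j ∈ nearby M k) :
    ‖latticePoint j - latticePoint k‖ ≤ √d * M := by
  refine norm_le_sqrt_mul _ _ (Nat.cast_nonneg _) fun i => ?_
  have := mem_nearby.1 h i
  simp only [latticePoint, PiLp.sub_apply, abs_le]
  constructor
  · have : ((k i - M : ℤ) : ℝ) ≤ (j i : ℤ) := Int.cast_le.2 this.1
    push_cast at this; linarith
  · have : ((j i : ℤ) : ℝ) ≤ (k i + M : ℤ) := Int.cast_le.2 this.2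
    push_cast at this; linarith

lemma finite_latticePoint_norm_le {d : ℕ} (c : ℝ) :
    {j : Fin d → ℤ | ‖latticePoint j‖ ≤ c}.Finite := by
  refine (Finset.finite_toSet (nearby ⌈c⌉₊ (0 : Fin d → ℤ))).subset fun j hj => ?_
  rw [Finset.mem_coe, mem_nearby]
  intro i
  have h1 : |(j i : ℝ)| ≤ ⌈c⌉₊ :=
    (abs_coord_le_norm (latticePoint j) i).trans (le_trans hj (Nat.le_ceil c))
  rw [abs_le] at h1
  constructor
  · have : ((-⌈c⌉₊ : ℤ) : ℝ) ≤ (j i : ℤ) := by push_cast; exact h1.1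
    have := Int.cast_le.1 this
    simpa using this
  · have : ((j i : ℤ) : ℝ) ≤ ((⌈c⌉₊ : ℤ) : ℝ) := by push_cast; exact h1.2
    have := Int.cast_le.1 this
    simpa using this

/-! ### Restriction and gluing of configurations -/

namespace MarkedConf

variable {d m : ℕ}

@[simp] lemma mem_restrict {Δ : Set (Pos d)} {γ : MarkedConf d m} {u : Pos d × Pos m} :
    u ∈ (γ.restrict Δ).carrier ↔ u ∈ γ.carrier ∧ u.1 ∈ Δ := Iff.rfl

@[simp] lemma mem_glue {Δ : Set (Pos d)} {η γ : MarkedConf d m} {u : Pos d × Pos m} :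
    u ∈ (glue Δ η γ).carrier ↔ (u ∈ γ.carrier ∧ u.1 ∈ Δ) ∨ (u ∈ η.carrier ∧ u.1 ∉ Δ) := Iff.rfl

lemma restrict_finite {Δ : Set (Pos d)} (hΔ : Bornology.IsBounded Δ) (γ : MarkedConf d m) :
    (γ.restrict Δ).carrier.Finite :=
  (γ.finite_of_isCompact (closure Δ) hΔ.isCompact_closure).subset
    fun _ hu => ⟨hu.1, subset_closure hu.2⟩

lemma restrict_restrict (Δ Δ' : Set (Pos d)) (γ : MarkedConf d m) :
    (γ.restrict Δ).restrict Δ' = γ.restrict (Δ ∩ Δ') := by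
  ext u; simp only [mem_restrict, Set.mem_inter_iff]; tauto

lemma glue_restrict_of_subset {Δ Δ' : Set (Pos d)} (h : Δ' ⊆ Δ) (η γ : MarkedConf d m) :
    (glue Δ η γ).restrict Δ' = γ.restrict Δ' := by
  ext u
  have := @h u.1
  simp only [mem_restrict, mem_glue]; tauto

lemma glue_restrict_of_disjoint {Δ Δ' : Set (Pos d)} (h : Disjoint Δ' Δ) (η γ : MarkedConf d m) :
    (glue Δ η γ).restrict Δ' = η.restrict Δ' := by
  ext u
  have : u.1 ∈ Δ' → u.1 ∉ Δ := fun h1 h2 => Set.disjoint_left.1 h h1 h2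
  simp only [mem_restrict, mem_glue]; tauto

lemma ncard_positions (γ : MarkedConf d m) : γ.positions.ncard = γ.carrier.ncard :=
  γ.injOn.ncard_image

lemma lyapunov_eq (p q : ℕ) (γ : MarkedConf d m) :
    lyapunov p q γ = (γ.carrier.ncard : ℝ) ^ p + ∑ᶠ u ∈ γ.carrier, ‖u.2‖ ^ q := by
  rw [lyapunov, ncard_positions]

lemma lyapunov_nonneg (p q : ℕ) (γ : MarkedConf d m) : 0 ≤ lyapunov p q γ :=
  add_nonneg (by positivity) (finsum_nonneg fun _ => finsum_nonneg fun _ => by positivity)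

lemma lyapunov_of_carrier_eq_empty {p : ℕ} (hp : p ≠ 0) (q : ℕ) {γ : MarkedConf d m}
    (h : γ.carrier = ∅) : lyapunov p q γ = 0 := by
  simp [lyapunov_eq, h, hp]

end MarkedConf

/-! ### Measurability on the configuration space -/

namespace MarkedConf

variable {d m : ℕ}

lemma ofTuple_of_not_injective {n : ℕ} {w : Fin n → Pos d × Pos m}
    (h : ¬ Function.Injective fun i => (w i).1) : (ofTuple w).carrier = ∅ := by
  rw [ofTuple, dif_neg h]

lemma carrier_ofTuple {n : ℕ} {w : Fin n → Pos d × Pos m}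
    (h : Function.Injective fun i => (w i).1) : (ofTuple w).carrier = Set.range w := by
  rw [ofTuple, dif_pos h]

lemma injective_of_injective_fst {ι : Type*} {w : ι → Pos d × Pos m}
    (h : Function.Injective fun i => (w i).1) : Function.Injective w :=
  fun _ _ hij => h (congrArg Prod.fst hij)

/-- Sums over the configuration of a tuple are sums over the indices of the tuple. -/
lemma finsum_mem_ofTuple {M : Type*} [AddCommMonoid M] {n : ℕ} {w : Fin n → Pos d × Pos m}
    (h : Function.Injective fun i => (w i).1) (f : Pos d × Pos m → M) :
    ∑ᶠ u ∈ (ofTuple w).carrier, f u = ∑ i, f (w i) := by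
  rw [carrier_ofTuple h, finsum_mem_range (injective_of_injective_fst h),
    finsum_eq_sum_of_fintype]

/-- The tuples of marked points with pairwise distinct positions. -/
def simpleTuples (d m n : ℕ) : Set (Fin n → Pos d × Pos m) :=
  {w | Function.Injective fun i => (w i).1}

lemma isOpen_simpleTuples (n : ℕ) : IsOpen (simpleTuples d m n) := by
  have : simpleTuples d m n =
      ⋂ i, ⋂ j, {w : Fin n → Pos d × Pos m | i ≠ j → (w i).1 ≠ (w j).1} := by
    ext w
    simp only [simpleTuples, Function.Injective, Set.mem_ofPred_eq, Set.mem_iInter]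
    exact forall₂_congr fun i j => not_imp_not.symm
  rw [this]
  refine isOpen_iInter_of_finite fun i => isOpen_iInter_of_finite fun j => ?_
  by_cases hij : i = j
  · simp [hij]
  · simp only [ne_eq, hij, not_false_eq_true, forall_const]
    exact isOpen_ne_fun (by fun_prop) (by fun_prop)

lemma measurableSet_simpleTuples (n : ℕ) : MeasurableSet (simpleTuples d m n) :=
  (isOpen_simpleTuples n).measurableSet

lemma continuousOn_ofTuple (n : ℕ) :
    ContinuousOn (ofTuple : (Fin n → Pos d × Pos m) → MarkedConf d m) (simpleTuples d m n) := by
  rw [continuousOn_iff_continuous_domRestrict, continuous_iInf_rng]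
  intro f
  rw [continuous_induced_rng]
  have : (pairing f.1 ∘ (simpleTuples d m n).domRestrict ofTuple) =
      fun w => ∑ i, f.1 (w.1 i) := by
    ext w
    exact finsum_mem_ofTuple w.2 _
  rw [this]
  have := f.2.1
  exact continuous_finsetSum _ fun i _ =>
    this.comp ((continuous_apply i).comp continuous_subtype_val)

lemma measurable_ofTuple (n : ℕ) :
    Measurable (ofTuple : (Fin n → Pos d × Pos m) → MarkedConf d m) := by
  classical
  refine measurable_of_restrict_of_restrict_compl (measurableSet_simpleTuples n)
    (continuousOn_iff_continuous_domRestrict.1 (continuousOn_ofTuple n)).measurable ?_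
  refine measurable_const' fun w w' => ?_
  ext1
  simp only [Set.domRestrict_apply]
  rw [ofTuple_of_not_injective w.2, ofTuple_of_not_injective w'.2]

lemma measurable_pairing {f : Pos d × Pos m → ℝ} (hf : IsTestFunction f) :
    Measurable (pairing (d := d) (m := m) f) := by
  have : Continuous (pairing (d := d) (m := m) f) := by
    rw [continuous_iff_le_induced]
    exact iInf_le (fun f : {f : Pos d × Pos m → ℝ // IsTestFunction f} =>
      TopologicalSpace.induced (pairing f.1) inferInstance) ⟨f, hf⟩
  exact this.measurable

lemma finite_inter_support {f : Pos d × Pos m → ℝ} (hf : IsTestFunction f) (γ : MarkedConf d m) :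
    (γ.carrier ∩ Function.support f).Finite := by
  obtain ⟨Λ, hΛ, h⟩ := hf.2.2
  exact (γ.finite_of_isCompact Λ hΛ).subset fun u hu => ⟨hu.1, (h hu.2).1⟩

/-- A tent function centred at `c` with radius `ρ`. -/
noncomputable def tent (c : Pos d × Pos m) (ρ : ℝ) (u : Pos d × Pos m) : ℝ := max 0 (ρ - dist u c)

lemma isTestFunction_tent (c : Pos d × Pos m) (ρ : ℝ) : IsTestFunction (tent c ρ) := by
  refine ⟨by unfold tent; fun_prop, ⟨|ρ|, fun u => ?_⟩, Metric.closedBall c.1 ρ,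
    isCompact_closedBall _ _, fun u hu => ⟨?_, trivial⟩⟩
  · have := dist_nonneg (x := u) (y := c)
    have := le_abs_self ρ
    rw [tent, abs_of_nonneg (le_max_left _ _)]
    exact max_le (abs_nonneg _) (by linarith)
  · rw [Function.mem_support, tent] at hu
    have h : 0 < ρ - dist u c := by
      by_contra! h
      exact hu (max_eq_left h)
    have h1 : dist u.1 c.1 ≤ dist u c := le_max_left _ _
    rw [Metric.mem_closedBall]; linarith

lemma tent_pos_iff {c u : Pos d × Pos m} {ρ : ℝ} : 0 < tent c ρ u ↔ dist u c < ρ := by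
  simp [tent]

lemma tent_nonneg (c u : Pos d × Pos m) (ρ : ℝ) : 0 ≤ tent c ρ u := le_max_left _ _

lemma pairing_tent_pos_iff {c : Pos d × Pos m} {ρ : ℝ} {γ : MarkedConf d m} :
    0 < pairing (tent c ρ) γ ↔ ∃ u ∈ γ.carrier, dist u c < ρ := by
  classical
  have hfin := finite_inter_support (isTestFunction_tent c ρ) γ
  have : pairing (tent c ρ) γ = ∑ u ∈ hfin.toFinset, tent c ρ u := by
    rw [pairing, ← finsum_mem_inter_support]
    exact finsum_mem_eq_finite_toFinset_sum _ hfin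
  rw [this, Finset.sum_pos_iff_of_nonneg fun u _ => tent_nonneg c u ρ]
  constructor
  · rintro ⟨u, hu, h⟩
    exact ⟨u, (hfin.mem_toFinset.1 hu).1, tent_pos_iff.1 h⟩
  · rintro ⟨u, hu, h⟩
    exact ⟨u, hfin.mem_toFinset.2 ⟨hu, (tent_pos_iff.2 h).ne'⟩, tent_pos_iff.2 h⟩

/-- Countably many tents detect every point of a configuration. -/
lemma carrier_subset_of_pairing_tent {γ γ' : MarkedConf d m}
    (h : ∀ n n' : ℕ, 0 < pairing (tent (TopologicalSpace.denseSeq (Pos d × Pos m) n)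
        (1 / ((n' : ℝ) + 1))) γ →
      0 < pairing (tent (TopologicalSpace.denseSeq (Pos d × Pos m) n) (1 / ((n' : ℝ) + 1))) γ') :
    γ.carrier ⊆ γ'.carrier := by
  intro u hu
  by_contra hu'
  have hfin : {v ∈ γ'.carrier | v.1 ∈ Metric.closedBall u.1 1}.Finite :=
    γ'.finite_of_isCompact _ (isCompact_closedBall _ _)
  obtain ⟨ε, hε, hball⟩ := Metric.isOpen_iff.1 hfin.isClosed.isOpen_compl u fun hmem => hu' hmem.1
  obtain ⟨n', hn'⟩ := exists_nat_one_div_lt (show 0 < min ε 1 / 2 by positivity)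
  obtain ⟨n, hn⟩ := (TopologicalSpace.denseRange_denseSeq (Pos d × Pos m)).exists_dist_lt u
    (show (0 : ℝ) < 1 / ((n' : ℝ) + 1) by positivity)
  obtain ⟨v, hv, hvn⟩ := pairing_tent_pos_iff.1 (h n n' (pairing_tent_pos_iff.2 ⟨u, hu, hn⟩))
  have hvu : dist v u < min ε 1 := by
    have := dist_triangle_right v u (TopologicalSpace.denseSeq (Pos d × Pos m) n)
    linarith
  refine hball (Metric.mem_ball.2 (hvu.trans_le (min_le_left _ _))) ⟨hv, ?_⟩
  rw [Metric.mem_closedBall]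
  exact (le_max_left _ _ : dist v.1 u.1 ≤ dist v u).trans (hvu.le.trans (min_le_right _ _))

instance : MeasurableSpace.CountablySeparated (MarkedConf d m) := by
  refine ⟨⟨⟨Set.range fun n : ℕ × ℕ => {γ : MarkedConf d m | 0 < pairing
    (tent (TopologicalSpace.denseSeq (Pos d × Pos m) n.1) (1 / ((n.2 : ℝ) + 1))) γ},
    Set.countable_range _, ?_, ?_⟩⟩⟩
  · rintro _ ⟨n, rfl⟩
    exact measurableSet_lt measurable_const (measurable_pairing (isTestFunction_tent _ _))
  · intro γ _ γ' _ h
    have h' : ∀ n n' : ℕ, 0 < pairing (tent (TopologicalSpace.denseSeq (Pos d × Pos m) n)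
        (1 / ((n' : ℝ) + 1))) γ ↔
      0 < pairing (tent (TopologicalSpace.denseSeq (Pos d × Pos m) n) (1 / ((n' : ℝ) + 1))) γ' :=
      fun n n' => h _ ⟨(n, n'), rfl⟩
    ext1
    exact (carrier_subset_of_pairing_tent fun n n' => (h' n n').1).antisymm
      (carrier_subset_of_pairing_tent fun n n' => (h' n n').2)

/-- A cutoff function of the position, increasing to `1` as the radius grows. -/
noncomputable def cutoff (ρ : ℝ) (u : Pos d × Pos m) : ℝ := max 0 (min 1 (ρ - ‖u.1‖))

lemma isTestFunction_cutoff (ρ : ℝ) : IsTestFunction (cutoff (d := d) (m := m) ρ) := by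
  refine ⟨by unfold cutoff; fun_prop, ⟨1, fun u => ?_⟩, Metric.closedBall 0 ρ,
    isCompact_closedBall _ _, fun u hu => ⟨?_, trivial⟩⟩
  · rw [cutoff, abs_of_nonneg (le_max_left _ _)]
    exact max_le zero_le_one (min_le_left _ _)
  · rw [Function.mem_support, cutoff] at hu
    have h : 0 < min 1 (ρ - ‖u.1‖) := by
      by_contra! h
      exact hu (max_eq_left h)
    rw [lt_min_iff] at h
    rw [mem_closedBall_zero_iff]; linarith

/-- The number of points of a configuration is the supremum of its pairings with cutoffs. -/
lemma encard_le_iff {γ : MarkedConf d m} {n : ℕ} :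
    γ.carrier.encard ≤ n ↔ ∀ N : ℕ, pairing (cutoff (N : ℝ)) γ ≤ n := by
  classical
  constructor
  · intro h N
    have hfin : γ.carrier.Finite := Set.finite_of_encard_le_coe h
    have : pairing (cutoff (N : ℝ)) γ = ∑ u ∈ hfin.toFinset, cutoff (N : ℝ) u :=
      finsum_mem_eq_finite_toFinset_sum _ hfin
    rw [this]
    calc ∑ u ∈ hfin.toFinset, cutoff (N : ℝ) u ≤ ∑ _u ∈ hfin.toFinset, (1 : ℝ) :=
          Finset.sum_le_sum fun u _ => max_le zero_le_one (min_le_left _ _)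
      _ = hfin.toFinset.card := by simp
      _ ≤ n := by
          rw [hfin.encard_eq_coe_toFinset_card] at h
          exact_mod_cast h
  · intro h
    by_contra! hlt
    obtain ⟨t, ht, hcard⟩ := Set.exists_subset_encard_eq (k := ((n + 1 : ℕ) : ℕ∞))
      (s := γ.carrier) (by simpa using Order.add_one_le_of_lt hlt)
    have htf : t.Finite := Set.finite_of_encard_eq_coe hcard
    have hcard' : htf.toFinset.card = n + 1 := by
      rw [htf.encard_eq_coe_toFinset_card] at hcard
      exact_mod_cast hcard
    -- a cutoff that equals `1` on the `n + 1` chosen points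
    obtain ⟨N, hN⟩ := exists_nat_ge (∑ u ∈ htf.toFinset, ‖u.1‖ + 1)
    have hone : ∀ u ∈ htf.toFinset, cutoff (N : ℝ) u = 1 := by
      intro u hu
      have : ‖u.1‖ ≤ ∑ u ∈ htf.toFinset, ‖u.1‖ :=
        Finset.single_le_sum (f := fun u : Pos d × Pos m => ‖u.1‖)
          (fun _ _ => norm_nonneg _) hu
      rw [cutoff, min_eq_left (by linarith), max_eq_right zero_le_one]
    have hfin := finite_inter_support (isTestFunction_cutoff (N : ℝ)) γ
    have hsum : pairing (cutoff (N : ℝ)) γ = ∑ u ∈ hfin.toFinset, cutoff (N : ℝ) u := by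
      rw [pairing, ← finsum_mem_inter_support]
      exact finsum_mem_eq_finite_toFinset_sum _ hfin
    have hsub : htf.toFinset ⊆ hfin.toFinset := by
      intro u hu
      refine hfin.mem_toFinset.2 ⟨ht (htf.mem_toFinset.1 hu), ?_⟩
      rw [Function.mem_support, hone u hu]; exact one_ne_zero
    have h1 := h N
    rw [hsum] at h1
    have h2 := Finset.sum_le_sum_of_subset_of_nonneg hsub
      (f := fun u : Pos d × Pos m => cutoff (N : ℝ) u) fun u _ _ => le_max_left _ _
    rw [Finset.sum_congr rfl hone, Finset.sum_const, hcard'] at h2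
    simp only [nsmul_eq_mul, mul_one, Nat.cast_add, Nat.cast_one] at h2
    linarith

lemma measurableSet_encard_le (n : ℕ) :
    MeasurableSet {γ : MarkedConf d m | γ.carrier.encard ≤ n} := by
  simp only [encard_le_iff, Set.ofPred_forall]
  exact MeasurableSet.iInter fun N =>
    measurableSet_le (measurable_pairing (isTestFunction_cutoff _)) measurable_const

lemma measurableSet_encard_eq (n : ℕ) :
    MeasurableSet {γ : MarkedConf d m | γ.carrier.encard = (n : ℕ∞)} := by
  cases n with
  | zero =>
    convert measurableSet_encard_le (d := d) (m := m) 0 using 3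
    simp
  | succ n =>
    have : {γ : MarkedConf d m | γ.carrier.encard = ((n + 1 : ℕ) : ℕ∞)} =
        {γ : MarkedConf d m | γ.carrier.encard ≤ ((n + 1 : ℕ) : ℕ∞)} \
          {γ : MarkedConf d m | γ.carrier.encard ≤ n} := by
      ext γ
      simp only [Set.mem_ofPred_eq, Set.mem_sdiff, not_le]
      constructor
      · intro h
        rw [h]
        exact ⟨le_rfl, by exact_mod_cast Nat.lt_succ_self n⟩
      · rintro ⟨h1, h2⟩
        refine le_antisymm h1 ?_
        have := Order.add_one_le_of_lt h2
        simpa using this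
    rw [this]
    exact (measurableSet_encard_le _).diff (measurableSet_encard_le _)

lemma range_ofTuple_restrict (n : ℕ) :
    Set.range ((simpleTuples d m n).domRestrict (ofTuple (d := d) (m := m))) =
      {γ : MarkedConf d m | γ.carrier.encard = (n : ℕ∞)} := by
  ext γ
  constructor
  · rintro ⟨w, rfl⟩
    simp only [Set.mem_ofPred_eq, Set.domRestrict_apply]
    rw [carrier_ofTuple w.2, ← Set.image_univ,
      (injective_of_injective_fst w.2).encard_image]
    simp
  · intro (h : γ.carrier.encard = n)
    have hfin : γ.carrier.Finite := Set.finite_of_encard_eq_coe h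
    have hcard : hfin.toFinset.card = n := by
      rw [hfin.encard_eq_coe_toFinset_card] at h
      exact_mod_cast h
    let e := (hfin.toFinset.equivFinOfCardEq hcard).symm
    have hinj : Function.Injective fun i => ((e i : Pos d × Pos m)).1 := by
      intro i j hij
      have := γ.injOn (hfin.mem_toFinset.1 (e i).2) (hfin.mem_toFinset.1 (e j).2) hij
      exact e.injective (Subtype.ext this)
    refine ⟨⟨fun i => e i, hinj⟩, ?_⟩
    ext u
    simp only [Set.domRestrict_apply]
    rw [carrier_ofTuple hinj]
    constructor
    · rintro ⟨i, rfl⟩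
      exact hfin.mem_toFinset.1 (e i).2
    · intro hu
      exact ⟨e.symm ⟨u, hfin.mem_toFinset.2 hu⟩, by simp⟩

/-- A function of configurations is tuple measurable if it is measurable as a function of the
tuples of points, for every number of points. -/
def TupleMeasurable {β : Type*} [MeasurableSpace β] (f : MarkedConf d m → β) : Prop :=
  ∀ n : ℕ, Measurable fun w : simpleTuples d m n => f (ofTuple w.1)

/-- By the Lusin--Souslin theorem, a function on `Γ(X, S)` is measurable on the set of
configurations with `n` points as soon as it is measurable in the tuple of points. -/
lemma TupleMeasurable.aemeasurable_map {β : Type*} [MeasurableSpace β] [Nonempty β]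
    {f : MarkedConf d m → β} (hf : TupleMeasurable f) (n : ℕ)
    (μ : Measure (Fin n → Pos d × Pos m)) :
    AEMeasurable f ((μ.restrict (simpleTuples d m n)).map ofTuple) := by
  classical
  let g : simpleTuples d m n → MarkedConf d m := (simpleTuples d m n).domRestrict ofTuple
  have hg : Measurable g :=
    (continuousOn_iff_continuous_domRestrict.1 (continuousOn_ofTuple n)).measurable
  have : StandardBorelSpace (simpleTuples d m n) := (measurableSet_simpleTuples n).standardBorel
  have hS : MeasurableSet (Set.range g) := by
    rw [range_ofTuple_restrict]; exact measurableSet_encard_eq n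
  have hfac : Measurable (f ∘ (Subtype.val : Set.range g → MarkedConf d m)) := by
    have hg' : Measurable (Set.rangeFactorization g) := hg.subtype_mk
    have : MeasurableSpace.CountablySeparated (Set.range g) := MeasurableSpace.Subtype.countablySeparated
    rw [← hg'.measurable_comp_iff_of_surjective Set.rangeFactorization_surjective]
    exact hf n
  have h1 : AEMeasurable f (((μ.restrict (simpleTuples d m n)).map ofTuple).restrict
      (Set.range g)) := aemeasurable_restrict_of_measurable_subtype hS hfac
  have hae : ∀ᵐ γ ∂((μ.restrict (simpleTuples d m n)).map ofTuple), γ ∈ Set.range g := by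
    refine (ae_map_iff (measurable_ofTuple n).aemeasurable hS).2 ?_
    filter_upwards [ae_restrict_mem (measurableSet_simpleTuples n)] with w hw
    exact ⟨⟨w, hw⟩, rfl⟩
  rwa [Measure.restrict_eq_self_of_ae_mem hae] at h1

end MarkedConf

/-! ### Product integrals and exponential series -/

lemma lintegral_fin_prod_eq_pow {X : Type*} [MeasurableSpace X] (κ : Measure X) [SigmaFinite κ]
    {φ : X → ℝ≥0∞} (hφ : Measurable φ) (n : ℕ) :
    ∫⁻ w : Fin n → X, ∏ i, φ (w i) ∂Measure.pi (fun _ => κ) = (∫⁻ x, φ x ∂κ) ^ n := by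
  induction n with
  | zero => simp
  | succ n ih =>
    have h := measurePreserving_piFinSuccAbove (fun _ : Fin (n + 1) => κ) 0
    have h1 : ∀ w : Fin (n + 1) → X, ∏ i, φ (w i) =
        (fun y : X × (Fin n → X) => φ y.1 * ∏ i, φ (y.2 i))
          (MeasurableEquiv.piFinSuccAbove (fun _ => X) 0 w) := by
      intro w
      simp [Fin.prod_univ_succ, MeasurableEquiv.piFinSuccAbove, Fin.tail]
    rw [lintegral_congr h1]
    refine (h.lintegral_comp (f := fun y : X × (Fin n → X) => φ y.1 * ∏ i, φ (y.2 i))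
      (by fun_prop)).trans ?_
    rw [lintegral_prod_mul (f := φ) (g := fun v : Fin n → X => ∏ i, φ (v i))
        hφ.aemeasurable (Measurable.aemeasurable (by fun_prop)), ih, pow_succ']

/-- Reindexing a product integral along a bijection of the index set. -/
lemma lintegral_pi_comp_equiv {X ι ι' : Type*} [MeasurableSpace X] [Fintype ι] [Fintype ι']
    (κ : Measure X) [SigmaFinite κ] (e : ι' ≃ ι) {f : (ι' → X) → ℝ≥0∞} :
    ∫⁻ w : ι → X, f (fun i => w (e i)) ∂Measure.pi (fun _ => κ) =
      ∫⁻ v, f v ∂Measure.pi (fun _ => κ) := by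
  have h := (measurePreserving_piCongrLeft (fun _ : ι => κ) e).symm
  exact h.lintegral_comp_emb (MeasurableEquiv.measurableEmbedding _) f

lemma lintegral_fintype_prod_eq_pow {X ι : Type*} [MeasurableSpace X] [Fintype ι]
    (κ : Measure X) [SigmaFinite κ] {φ : X → ℝ≥0∞} (hφ : Measurable φ) :
    ∫⁻ w : ι → X, ∏ i, φ (w i) ∂Measure.pi (fun _ => κ) =
      (∫⁻ x, φ x ∂κ) ^ Fintype.card ι := by
  rw [← lintegral_fin_prod_eq_pow κ hφ,
    ← lintegral_pi_comp_equiv κ (Fintype.equivFin ι).symm]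
  refine lintegral_congr fun w => ?_
  exact ((Fintype.equivFin ι).symm.prod_comp fun i => φ (w i)).symm

/-- The coefficient `z ^ n / n!` of the Lebesgue--Poisson measure. -/
noncomputable def poissonCoeff (z : ℝ) (n : ℕ) : ℝ≥0∞ := ENNReal.ofReal (z ^ n / n.factorial)

lemma poissonCoeff_mul_choose {z : ℝ} (hz : 0 < z) (i j : ℕ) :
    poissonCoeff z (i + j) * ((i + j).choose i : ℕ) = poissonCoeff z i * poissonCoeff z j := by
  have h : ((i + j).choose i : ℝ) * (i.factorial * j.factorial) = (i + j).factorial := by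
    have := Nat.add_choose_mul_factorial_mul_factorial i j
    rw [Nat.choose_symm_add, ← mul_assoc]; exact_mod_cast this
  rw [poissonCoeff, poissonCoeff, poissonCoeff, ← ENNReal.ofReal_natCast,
    ← ENNReal.ofReal_mul (by positivity), ← ENNReal.ofReal_mul (by positivity)]
  congr 1
  rw [← h, pow_add]
  have : ((i + j).choose i : ℝ) ≠ 0 := by
    exact_mod_cast (Nat.choose_pos (Nat.le_add_right i j)).ne'
  field_simp

/-- The exponential series `∑ z ^ n / n! * a ^ n` in `[0, ∞]`. -/
noncomputable def poissonSeries (z : ℝ) (a : ℝ≥0∞) : ℝ≥0∞ := ∑' n, poissonCoeff z n * a ^ n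

lemma poissonSeries_lt_top {z : ℝ} (hz : 0 < z) {a : ℝ≥0∞} (ha : a ≠ ∞) :
    poissonSeries z a < ∞ := by
  lift a to ℝ≥0 using ha
  have h : ∀ n, poissonCoeff z n * (a : ℝ≥0∞) ^ n =
      ENNReal.ofReal ((z * a) ^ n / n.factorial) := fun n => by
    rw [poissonCoeff, ← ENNReal.ofReal_coe_nnreal, ← ENNReal.ofReal_pow (NNReal.coe_nonneg a),
      ← ENNReal.ofReal_mul (by positivity)]
    congr 1
    rw [mul_pow]; ring
  simp_rw [poissonSeries, h]
  rw [← ENNReal.ofReal_tsum_of_nonneg (fun n => by positivity)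
    (Real.summable_pow_div_factorial _)]
  exact ENNReal.ofReal_lt_top

lemma poissonSeries_mono (z : ℝ) {a b : ℝ≥0∞} (h : a ≤ b) :
    poissonSeries z a ≤ poissonSeries z b :=
  ENNReal.tsum_le_tsum fun n => by gcongr

/-- The binomial theorem for exponential generating series. -/
lemma tsum_poissonCoeff_mul_sum_powerset {z : ℝ} (hz : 0 < z) (a : ℝ≥0∞) (b : ℕ → ℝ≥0∞) :
    ∑' n, poissonCoeff z n *
        ∑ I ∈ (Finset.univ : Finset (Fin n)).powerset, a ^ I.card * b (n - I.card) =
      poissonSeries z a * ∑' n, poissonCoeff z n * b n := by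
  have h : ∀ n, poissonCoeff z n *
        ∑ I ∈ (Finset.univ : Finset (Fin n)).powerset, a ^ I.card * b (n - I.card) =
      ∑ x ∈ Finset.HasAntidiagonal.antidiagonal n,
        (poissonCoeff z x.1 * a ^ x.1) * (poissonCoeff z x.2 * b x.2) := fun n => by
    rw [Finset.sum_powerset_apply_card (fun i => a ^ i * b (n - i)), Finset.card_univ,
      Fintype.card_fin, Finset.mul_sum, Finset.Nat.sum_antidiagonal_eq_sum_range_succ_mk]
    refine Finset.sum_congr rfl fun i hi => ?_
    have hin : i + (n - i) = n := by
      have := Finset.mem_range.1 hi; omega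
    have h' := poissonCoeff_mul_choose hz i (n - i)
    rw [hin] at h'
    rw [nsmul_eq_mul, ← mul_assoc, h']
    ring
  simp_rw [h]
  rw [poissonSeries, ← ENNReal.tsum_mul_right]
  simp_rw [← ENNReal.tsum_mul_left]
  rw [← ENNReal.tsum_prod (f := fun i j =>
    (poissonCoeff z i * a ^ i) * (poissonCoeff z j * b j)),
    ← Finset.HasAntidiagonal.sigmaAntidiagonalEquivProd.tsum_eq, ENNReal.tsum_sigma']
  refine tsum_congr fun n => ?_
  rw [tsum_fintype]
  exact (Finset.sum_coe_sort (Finset.HasAntidiagonal.antidiagonal n) fun x : ℕ × ℕ =>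
    (poissonCoeff z x.1 * a ^ x.1) * (poissonCoeff z x.2 * b x.2)).symm

/-! ### Integration against the Lebesgue--Poisson measure -/

namespace MarkedConf

variable {d m : ℕ}

lemma TupleMeasurable.measurable_comp_ofTuple {β : Type*} [MeasurableSpace β]
    {f : MarkedConf d m → β} (hf : TupleMeasurable f) (n : ℕ) :
    Measurable fun w : Fin n → Pos d × Pos m => f (ofTuple w) := by
  refine measurable_of_restrict_of_restrict_compl (measurableSet_simpleTuples n) (hf n) ?_
  refine measurable_const' fun w w' => ?_
  have : ofTuple w.1 = ofTuple w'.1 := by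
    ext1
    rw [ofTuple_of_not_injective w.2, ofTuple_of_not_injective w'.2]
  simp only [Set.domRestrict_apply]
  rw [this]

lemma restrict_ofTuple_eq_empty {n : ℕ} {w : Fin n → Pos d × Pos m} (hw : w ∈ simpleTuples d m n)
    {A : Set (Pos d)} : ((ofTuple w).restrict A).carrier = ∅ ↔ ∀ i, (w i).1 ∉ A := by
  rw [Set.eq_empty_iff_forall_notMem]
  simp only [mem_restrict, carrier_ofTuple hw]
  constructor
  · exact fun h i hi => h (w i) ⟨⟨i, rfl⟩, hi⟩
  · rintro h _ ⟨⟨i, rfl⟩, hi⟩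
    exact h i hi

lemma measurable_fst_apply {n : ℕ} (i : Fin n) :
    Measurable fun w : Fin n → Pos d × Pos m => (w i).1 := by fun_prop

lemma measurableSet_forall_notMem {A : Set (Pos d)} (hA : MeasurableSet A) (n : ℕ) :
    MeasurableSet {w : Fin n → Pos d × Pos m | ∀ i, (w i).1 ∉ A} := by
  rw [Set.ofPred_forall]
  exact MeasurableSet.iInter fun i => measurable_fst_apply i hA.compl

lemma TupleMeasurable.indicator_restrict_eq_empty {G : MarkedConf d m → ℝ≥0∞}
    (hG : TupleMeasurable G) {A : Set (Pos d)} (hA : MeasurableSet A) :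
    TupleMeasurable ({γ : MarkedConf d m | (γ.restrict A).carrier = ∅}.indicator G) := by
  intro n
  have : (fun w : simpleTuples d m n =>
      {γ : MarkedConf d m | (γ.restrict A).carrier = ∅}.indicator G (ofTuple w.1)) =
      (Subtype.val ⁻¹' {w | ∀ i, (w i).1 ∉ A}).indicator fun w => G (ofTuple w.1) := by
    funext w
    by_cases h : ∀ i, (w.1 i).1 ∉ A
    · rw [Set.indicator_of_mem (show w ∈ Subtype.val ⁻¹' {w | ∀ i, (w i).1 ∉ A} from h)]
      exact Set.indicator_of_mem (s := {γ : MarkedConf d m | (γ.restrict A).carrier = ∅})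
        ((restrict_ofTuple_eq_empty w.2).2 h) G
    · rw [Set.indicator_of_notMem (show w ∉ Subtype.val ⁻¹' {w | ∀ i, (w i).1 ∉ A} from h)]
      exact Set.indicator_of_notMem (s := {γ : MarkedConf d m | (γ.restrict A).carrier = ∅})
        (fun h' => h ((restrict_ofTuple_eq_empty w.2).1 h')) G
  rw [this]
  exact (hG n).indicator (measurable_subtype_coe (measurableSet_forall_notMem hA n))

end MarkedConf

open MarkedConf

section LebesguePoisson

variable {d m : ℕ} (U : Potentials d m)

/-- The intensity of one particle in `Δ`: Lebesgue measure times the single-spin measure. -/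
noncomputable def Potentials.oneParticle (Δ : Set (Pos d)) : Measure (Pos d × Pos m) :=
  (volume.restrict Δ).prod U.spinMeasure

lemma lebesguePoisson_eq (z : ℝ) (Δ : Set (Pos d)) :
    U.lebesguePoisson z Δ = Measure.sum fun n : ℕ => poissonCoeff z n •
      ((Measure.pi fun _ : Fin n => U.oneParticle Δ).restrict
        (simpleTuples d m n)).map ofTuple := rfl

lemma MarkedConf.TupleMeasurable.aemeasurable {β : Type*} [MeasurableSpace β] [Nonempty β]
    {f : MarkedConf d m → β} (hf : TupleMeasurable f) (z : ℝ) (Δ : Set (Pos d)) :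
    AEMeasurable f (U.lebesguePoisson z Δ) := by
  rw [lebesguePoisson_eq, aemeasurable_sum_measure_iff]
  exact fun n => (hf.aemeasurable_map n _).smul_measure _

lemma lintegral_lebesguePoisson_le (z : ℝ) (Δ : Set (Pos d)) (f : MarkedConf d m → ℝ≥0∞) :
    ∫⁻ γ, f γ ∂U.lebesguePoisson z Δ ≤ ∑' n, poissonCoeff z n *
      ∫⁻ w in simpleTuples d m n, f (ofTuple w) ∂Measure.pi fun _ => U.oneParticle Δ := by
  rw [lebesguePoisson_eq, lintegral_sum_measure]
  refine ENNReal.tsum_le_tsum fun n => ?_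
  rw [lintegral_smul_measure, smul_eq_mul]
  gcongr
  exact lintegral_map_le _ _

lemma lintegral_lebesguePoisson (z : ℝ) (Δ : Set (Pos d)) {f : MarkedConf d m → ℝ≥0∞}
    (hf : TupleMeasurable f) :
    ∫⁻ γ, f γ ∂U.lebesguePoisson z Δ = ∑' n, poissonCoeff z n *
      ∫⁻ w in simpleTuples d m n, f (ofTuple w) ∂Measure.pi fun _ => U.oneParticle Δ := by
  rw [lebesguePoisson_eq, lintegral_sum_measure]
  refine tsum_congr fun n => ?_
  rw [lintegral_smul_measure, smul_eq_mul, lintegral_map' (hf.aemeasurable_map n _)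
    (measurable_ofTuple n).aemeasurable]

lemma lebesguePoisson_univ_lt_top {z : ℝ} (hz : 0 < z) (Δ : Set (Pos d))
    [IsFiniteMeasure (U.oneParticle Δ)] :
    U.lebesguePoisson z Δ Set.univ < ∞ := by
  rw [← lintegral_one]
  refine (lintegral_lebesguePoisson_le U z Δ _).trans_lt ?_
  refine lt_of_le_of_lt ?_ (poissonSeries_lt_top hz (measure_ne_top (U.oneParticle Δ) Set.univ))
  refine ENNReal.tsum_le_tsum fun n => ?_
  gcongr
  refine (setLIntegral_le_lintegral _ _).trans ?_
  rw [lintegral_one, Measure.pi_univ]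
  simp

/-- The part of a configuration of a tuple outside `A`, when the indices of the points outside `A`
are listed by `e`. -/
lemma restrict_compl_ofTuple {n j : ℕ} {A : Set (Pos d)} {w : Fin n → Pos d × Pos m}
    (hw : w ∈ simpleTuples d m n) {I : Finset (Fin n)} (hI : ∀ i, (w i).1 ∈ A ↔ i ∈ I)
    (e : Fin j ≃ {i // i ∉ I}) :
    (fun t => w (e t)) ∈ simpleTuples d m j ∧
      (ofTuple w).restrict Aᶜ = ofTuple fun t => w (e t) := by
  have hinj : (fun t => w (e t)) ∈ simpleTuples d m j := fun s t hst =>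
    e.injective (Subtype.ext (hw hst))
  refine ⟨hinj, ?_⟩
  ext u
  rw [mem_restrict, carrier_ofTuple hw, carrier_ofTuple hinj]
  constructor
  · rintro ⟨⟨i, rfl⟩, hu⟩
    have hi : i ∉ I := fun hi => hu ((hI i).2 hi)
    exact ⟨e.symm ⟨i, hi⟩, by simp⟩
  · rintro ⟨t, rfl⟩
    exact ⟨⟨_, rfl⟩, fun h => (e t).2 ((hI _).1 h)⟩

open scoped Classical in
/-- Integrating out the particles in `A`: a product over the points in `A` times a function of the
configuration outside `A` integrates to at most an exponential times the integral over the
configurations without points in `A`. -/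
theorem lintegral_prod_mul_restrict_compl_le {z : ℝ} (hz : 0 < z) (Δ : Set (Pos d))
    [SigmaFinite (U.oneParticle Δ)] {A : Set (Pos d)} (hA : MeasurableSet A)
    {φ : Pos d × Pos m → ℝ≥0∞} (hφ : Measurable φ) (f : MarkedConf d m → ℝ≥0∞)
    {G : MarkedConf d m → ℝ≥0∞} (hG : TupleMeasurable G)
    (hf : ∀ n, ∀ w ∈ simpleTuples d m n, f (ofTuple w) ≤
      (∏ i, if (w i).1 ∈ A then φ (w i) else 1) *
        G ((ofTuple w).restrict Aᶜ)) :
    ∫⁻ γ, f γ ∂U.lebesguePoisson z Δ ≤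
      poissonSeries z (∫⁻ u in Prod.fst ⁻¹' A, φ u ∂U.oneParticle Δ) *
        ∫⁻ γ, {γ | (γ.restrict A).carrier = ∅}.indicator G γ ∂U.lebesguePoisson z Δ := by
  set κ := U.oneParticle Δ
  have hA' : MeasurableSet (Prod.fst ⁻¹' A : Set (Pos d × Pos m)) := measurable_fst hA
  -- the tuples without points in `A`
  let E : ∀ n, Set (Fin n → Pos d × Pos m) := fun n => {w | ∀ i, (w i).1 ∉ A}
  have hE : ∀ n, MeasurableSet (E n) := measurableSet_forall_notMem hA
  have hempty : ∀ n, ∀ w ∈ simpleTuples d m n,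
      (((ofTuple w).restrict A).carrier = ∅ ↔ w ∈ E n) := fun n w hw => restrict_ofTuple_eq_empty hw
  let Ψ : ∀ n, (Fin n → Pos d × Pos m) → ℝ≥0∞ := fun n =>
    (simpleTuples d m n ∩ E n).indicator fun w => G (ofTuple w)
  have hΨ : ∀ n, Measurable (Ψ n) := fun n =>
    (hG.measurable_comp_ofTuple n).indicator ((measurableSet_simpleTuples n).inter (hE n))
  let φA : Pos d × Pos m → ℝ≥0∞ := (Prod.fst ⁻¹' A).indicator φ
  have hφA : Measurable φA := hφ.indicator hA'
  set a := ∫⁻ u in Prod.fst ⁻¹' A, φ u ∂κ with ha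
  have ha' : ∫⁻ u, φA u ∂κ = a := lintegral_indicator hA' _
  let b : ℕ → ℝ≥0∞ := fun n => ∫⁻ w, Ψ n w ∂Measure.pi fun _ => κ
  -- the right-hand side
  have hR : ∫⁻ γ, {γ | (γ.restrict A).carrier = ∅}.indicator G γ ∂U.lebesguePoisson z Δ =
      ∑' n, poissonCoeff z n * b n := by
    have hind : ∀ n, ∀ w ∈ simpleTuples d m n,
        {γ : MarkedConf d m | (γ.restrict A).carrier = ∅}.indicator G (ofTuple w) = Ψ n w := by
      intro n w hw
      simp only [Ψ, Set.indicator, Set.mem_ofPred_eq, hempty n w hw, Set.mem_inter_iff, hw,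
        true_and]
    rw [lintegral_lebesguePoisson]
    · refine tsum_congr fun n => ?_
      rw [setLIntegral_congr_fun (measurableSet_simpleTuples n) (hind n)]
      congr 1
      rw [← lintegral_indicator (measurableSet_simpleTuples n)]
      refine lintegral_congr fun w => ?_
      simp only [Ψ, Set.indicator_indicator, ← Set.inter_assoc, Set.inter_self]
    · exact hG.indicator_restrict_eq_empty hA
  rw [hR, ← tsum_poissonCoeff_mul_sum_powerset hz]
  refine (lintegral_lebesguePoisson_le U z Δ f).trans (ENNReal.tsum_le_tsum fun n => ?_)
  gcongr
  -- split according to the set of indices whose points lie in `A`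
  let S : Finset (Fin n) → Set (Fin n → Pos d × Pos m) := fun I => {w | ∀ i, (w i).1 ∈ A ↔ i ∈ I}
  have hS : ∀ I, MeasurableSet (S I) := fun I => by
    have : S I = ⋂ i, {w : Fin n → Pos d × Pos m | (w i).1 ∈ A ↔ i ∈ I} := by
      ext w; simp [S]
    rw [this]
    refine MeasurableSet.iInter fun i => ?_
    have hmi : MeasurableSet ((fun w : Fin n → Pos d × Pos m => (w i).1) ⁻¹' A) :=
      (by fun_prop : Measurable fun w : Fin n → Pos d × Pos m => (w i).1) hA
    by_cases hi : i ∈ I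
    · simp only [hi, iff_true]; exact hmi
    · simp only [hi, iff_false]; exact hmi.compl
  have hcover : simpleTuples d m n = ⋃ I, simpleTuples d m n ∩ S I := by
    rw [← Set.inter_iUnion, eq_comm, Set.inter_eq_left]
    intro w _
    exact Set.mem_iUnion.2 ⟨Finset.univ.filter fun i => (w i).1 ∈ A, by simp [S]⟩
  rw [hcover, Finset.powerset_univ]
  refine (lintegral_iUnion_le _ _).trans ?_
  rw [tsum_fintype]
  refine Finset.sum_le_sum fun I _ => ?_
  have hcard : Fintype.card {i // i ∉ I} = n - I.card := by
    rw [Fintype.card_subtype_compl, Fintype.card_fin, Fintype.card_coe]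
  let e : Fin (n - I.card) ≃ {i // i ∉ I} := (Fintype.equivFinOfCardEq hcard).symm
  have hbound : ∀ w ∈ simpleTuples d m n ∩ S I, f (ofTuple w) ≤
      (fun y : ({i // i ∈ I} → Pos d × Pos m) × ({i // i ∉ I} → Pos d × Pos m) =>
        (∏ i, φA (y.1 i)) * Ψ _ (fun t => y.2 (e t)))
        (MeasurableEquiv.piEquivPiSubtypeProd (fun _ => Pos d × Pos m) (fun i => i ∈ I) w) := by
    rintro w ⟨hw, hwS⟩
    refine (hf n w hw).trans (le_of_eq ?_)
    obtain ⟨h1, h2⟩ := restrict_compl_ofTuple hw hwS e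
    have h3 : (fun t => w (e t)) ∈ simpleTuples d m (n - I.card) ∩ E (n - I.card) :=
      ⟨h1, fun t ht => (e t).2 ((hwS _).1 ht)⟩
    have h4 : (∏ i, if (w i).1 ∈ A then φ (w i) else 1) =
        ∏ i : {i // i ∈ I}, φA (w i) := by
      rw [← Finset.prod_subset (Finset.subset_univ I), ← Finset.prod_coe_sort]
      · refine Finset.prod_congr rfl fun i _ => ?_
        have : (w i).1 ∈ A := (hwS i).2 i.2
        simp [φA, this]
      · intro i _ hi
        have : (w i).1 ∉ A := fun h => hi ((hwS i).1 h)
        simp [this]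
    have h5 : Ψ _ (fun t => w (e t)) = G (ofTuple fun t => w (e t)) := Set.indicator_of_mem h3 _
    rw [h2, h4, ← h5]
    rfl
  have hm : Measurable fun y : ({i // i ∈ I} → Pos d × Pos m) × ({i // i ∉ I} → Pos d × Pos m) =>
        (∏ i, φA (y.1 i)) * Ψ _ (fun t => y.2 (e t)) := by
    have := hΨ (n - I.card)
    fun_prop
  calc ∫⁻ w in simpleTuples d m n ∩ S I, f (ofTuple w) ∂(Measure.pi fun _ => κ)
      ≤ ∫⁻ w in simpleTuples d m n ∩ S I,
          (fun y : ({i // i ∈ I} → Pos d × Pos m) × ({i // i ∉ I} → Pos d × Pos m) =>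
            (∏ i, φA (y.1 i)) * Ψ _ (fun t => y.2 (e t)))
          (MeasurableEquiv.piEquivPiSubtypeProd (fun _ => Pos d × Pos m) (fun i => i ∈ I) w)
          ∂(Measure.pi fun _ => κ) :=
        setLIntegral_mono' ((measurableSet_simpleTuples n).inter (hS I)) hbound
    _ ≤ _ := setLIntegral_le_lintegral _ _
    _ = ∫⁻ y, (∏ i, φA (y.1 i)) * Ψ _ (fun t => y.2 (e t))
          ∂((Measure.pi fun _ : {i // i ∈ I} => κ).prod
            (Measure.pi fun _ : {i // i ∉ I} => κ)) := by
        convert (measurePreserving_piEquivPiSubtypeProd (fun _ : Fin n => κ)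
          (fun i => i ∈ I)).lintegral_comp hm
    _ = (∫⁻ x : {i // i ∈ I} → Pos d × Pos m, ∏ i, φA (x i) ∂(Measure.pi fun _ => κ)) *
          ∫⁻ y : {i // i ∉ I} → Pos d × Pos m, Ψ _ (fun t => y (e t))
            ∂(Measure.pi fun _ => κ) := by
        have := hΨ (n - I.card)
        exact lintegral_prod_mul (f := fun x : {i // i ∈ I} → Pos d × Pos m => ∏ i, φA (x i))
          (g := fun y : {i // i ∉ I} → Pos d × Pos m => Ψ _ (fun t => y (e t)))
          (Measurable.aemeasurable (by fun_prop)) (Measurable.aemeasurable (by fun_prop))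
    _ = a ^ I.card * b (n - I.card) := by
        rw [lintegral_fintype_prod_eq_pow κ hφA, ha', lintegral_pi_comp_equiv κ e,
          Fintype.card_coe]

end LebesguePoisson

/-! ### Scalar inequalities of Young type -/

/-- A higher power dominates a lower one up to a constant. -/
lemma exists_mul_rpow_le {s S : ℝ} (hs : 0 ≤ s) (hsS : s < S) (c : ℝ) {ε : ℝ} (hε : 0 < ε) :
    ∃ C : ℝ, 0 ≤ C ∧ ∀ t : ℝ, 0 ≤ t → c * t ^ s ≤ ε * t ^ S + C := by
  set T := (|c| / ε) ^ (1 / (S - s)) with hT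
  have hT0 : 0 ≤ T := by positivity
  refine ⟨|c| * T ^ s, by positivity, fun t ht => ?_⟩
  have hc : c * t ^ s ≤ |c| * t ^ s := by gcongr; exact le_abs_self c
  refine hc.trans ?_
  rcases le_or_gt t T with h | h
  · have h1 : t ^ s ≤ T ^ s := Real.rpow_le_rpow ht h hs
    have : 0 ≤ ε * t ^ S := by positivity
    have := mul_le_mul_of_nonneg_left h1 (abs_nonneg c)
    linarith
  · have ht' : 0 < t := hT0.trans_lt h
    have h1 : |c| / ε ≤ t ^ (S - s) := by
      have h2 : T ^ (S - s) ≤ t ^ (S - s) := Real.rpow_le_rpow hT0 h.le (by linarith)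
      have h3 : T ^ (S - s) = |c| / ε := by
        rw [hT, ← Real.rpow_mul (by positivity), one_div, inv_mul_cancel₀ (by linarith),
          Real.rpow_one]
      linarith
    have h4 : |c| ≤ ε * t ^ (S - s) := by
      rw [div_le_iff₀ hε] at h1; linarith
    have h5 : t ^ S = t ^ (S - s) * t ^ s := by rw [← Real.rpow_add ht']; congr 1; ring
    have h6 : |c| * t ^ s ≤ ε * t ^ (S - s) * t ^ s := by gcongr
    have : 0 ≤ |c| * T ^ s := by positivity
    rw [h5]; linarith

/-- Young's inequality in the form dictated by the relation between the exponents `p`, `q`, `r`. -/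
lemma exists_natCast_mul_rpow_le {p q : ℕ} {r : ℝ} (hp : 2 < p) (hr : 0 < r)
    (hpq : 1 ≤ ((p : ℝ) - 2) * ((q : ℝ) / r - 1)) {δ : ℝ} (hδ : 0 < δ) :
    ∃ C : ℝ, 0 ≤ C ∧ ∀ (N : ℕ) (t : ℝ), 0 ≤ t →
      N * t ^ r ≤ δ * t ^ q + C * (N : ℝ) ^ (p - 1) := by
  have hp' : (2 : ℝ) < p := by exact_mod_cast hp
  have hqr : r < q := by
    by_contra! h
    have : (q : ℝ) / r ≤ 1 := by rw [div_le_one hr]; exact h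
    nlinarith
  have hqr' : 0 < (q : ℝ) - r := by linarith
  have hexp : r / (q - r) ≤ (p : ℝ) - 2 := by
    rw [div_le_iff₀ hqr']
    have := mul_le_mul_of_nonneg_right hpq hr.le
    have h1 : ((p : ℝ) - 2) * ((q : ℝ) / r - 1) * r = ((p : ℝ) - 2) * (q - r) := by
      field_simp
    linarith
  refine ⟨(1 / δ) ^ (r / (q - r)), by positivity, fun N t ht => ?_⟩
  rcases Nat.eq_zero_or_pos N with rfl | hN
  · have : (0 : ℝ) ≤ (((0 : ℕ) : ℝ)) ^ (p - 1) := by positivity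
    simp only [Nat.cast_zero, zero_mul]
    positivity
  have hN' : (1 : ℝ) ≤ N := by exact_mod_cast hN
  rcases le_or_gt (N : ℝ) (δ * t ^ ((q : ℝ) - r)) with h | h
  · have ht' : 0 < t := by
      rcases ht.eq_or_lt with rfl | h'
      · rw [Real.zero_rpow hqr'.ne'] at h; linarith
      · exact h'
    have h1 : t ^ q = t ^ ((q : ℝ) - r) * t ^ r := by
      rw [← Real.rpow_add ht', ← Real.rpow_natCast]; congr 1; ring
    have h2 : (N : ℝ) * t ^ r ≤ δ * t ^ ((q : ℝ) - r) * t ^ r := by gcongr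
    have : 0 ≤ (1 / δ) ^ (r / (q - r)) * (N : ℝ) ^ (p - 1) := by positivity
    rw [h1]; linarith
  · have h1 : t ^ ((q : ℝ) - r) ≤ N * (1 / δ) := by
      rw [mul_one_div, le_div_iff₀ hδ]; linarith
    have h2 : t ^ r ≤ (N : ℝ) ^ (r / (q - r)) * (1 / δ) ^ (r / (q - r)) := by
      rw [← Real.mul_rpow (by positivity) (by positivity)]
      calc t ^ r = (t ^ ((q : ℝ) - r)) ^ (r / (q - r)) := by
            rw [← Real.rpow_mul ht]; congr 1; field_simp
        _ ≤ _ := Real.rpow_le_rpow (by positivity) h1 (by positivity)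
    have h3 : (N : ℝ) ^ (r / (q - r)) ≤ (N : ℝ) ^ (p - 2) := by
      have h4 : ((p - 2 : ℕ) : ℝ) = (p : ℝ) - 2 := by
        rw [Nat.cast_sub hp.le]; norm_num
      rw [← Real.rpow_natCast, h4]
      exact Real.rpow_le_rpow_of_exponent_le hN' hexp
    have h5 : (N : ℝ) ^ (p - 1) = N * (N : ℝ) ^ (p - 2) := by
      rw [← pow_succ']; congr 1; omega
    have h6 : (N : ℝ) * t ^ r ≤ N * ((N : ℝ) ^ (p - 2) * (1 / δ) ^ (r / (q - r))) := by
      gcongr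
      exact h2.trans (by gcongr)
    have : 0 ≤ δ * t ^ q := by positivity
    rw [h5]; linarith

lemma exists_mul_pow_le {p : ℕ} (hp : 2 < p) {δ : ℝ} (hδ : 0 < δ) :
    ∃ C : ℝ, 0 ≤ C ∧ ∀ x y : ℝ, 0 ≤ x → 0 ≤ y →
      x * y ^ (p - 1) ≤ δ * y ^ p + C * x ^ p ∧ y * x ^ (p - 1) ≤ δ * y ^ p + C * x ^ p := by
  obtain ⟨l, rfl⟩ : ∃ l, p = l + 2 := ⟨p - 2, by omega⟩
  simp only [show l + 2 - 1 = l + 1 from rfl]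
  set ε := min δ 1 with hε
  have hε0 : 0 < ε := lt_min hδ one_pos
  have hε1 : ε ≤ 1 := min_le_right _ _
  have hεδ : ε ≤ δ := min_le_left _ _
  have hinv : 1 ≤ 1 / ε := by rw [le_div_iff₀ hε0]; linarith
  refine ⟨(1 / ε) ^ (l + 1), by positivity, fun x y hx hy => ?_⟩
  rcases le_or_gt x (ε * y) with h | h
  · have hC : 0 ≤ (1 / ε) ^ (l + 1) * x ^ (l + 2) := by positivity
    have h1 : ε * y * y ^ (l + 1) ≤ δ * y ^ (l + 2) := by
      rw [mul_assoc, ← pow_succ']; gcongr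
    constructor
    · have : x * y ^ (l + 1) ≤ ε * y * y ^ (l + 1) := by gcongr
      linarith
    · have h2 : x ^ (l + 1) ≤ ε * y ^ (l + 1) := by
        calc x ^ (l + 1) ≤ (ε * y) ^ (l + 1) := by gcongr
          _ = ε * ε ^ l * y ^ (l + 1) := by rw [mul_pow, pow_succ']
          _ ≤ ε * 1 * y ^ (l + 1) := by
            gcongr
            exact pow_le_one₀ hε0.le hε1
          _ = _ := by ring
      have : y * x ^ (l + 1) ≤ y * (ε * y ^ (l + 1)) := by gcongr
      linarith
  · have hy' : y ≤ 1 / ε * x := by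
      rw [one_div, ← div_eq_inv_mul, le_div_iff₀ hε0]; linarith
    have hC : 0 ≤ δ * y ^ (l + 2) := by positivity
    constructor
    · have : x * y ^ (l + 1) ≤ x * (1 / ε * x) ^ (l + 1) := by gcongr
      have h2 : x * (1 / ε * x) ^ (l + 1) = (1 / ε) ^ (l + 1) * x ^ (l + 2) := by
        rw [mul_pow]; ring
      linarith
    · have : y * x ^ (l + 1) ≤ 1 / ε * x * x ^ (l + 1) := by gcongr
      have h2 : 1 / ε * x * x ^ (l + 1) = 1 / ε * x ^ (l + 2) := by ring
      have h3 : 1 / ε * x ^ (l + 2) ≤ (1 / ε) ^ (l + 1) * x ^ (l + 2) := by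
        gcongr
        exact le_self_pow₀ hinv (by omega)
      linarith

/-- The functional `F` on finite sets of marked points. -/
noncomputable def finsetLyapunov {d m : ℕ} (p q : ℕ) (s : Finset (Pos d × Pos m)) : ℝ :=
  (s.card : ℝ) ^ p + ∑ u ∈ s, ‖u.2‖ ^ q

lemma finsetLyapunov_nonneg {d m : ℕ} (p q : ℕ) (s : Finset (Pos d × Pos m)) :
    0 ≤ finsetLyapunov p q s := by unfold finsetLyapunov; positivity

/-- The interaction of two finite families of particles is bounded by the functional `F`, with an
arbitrarily small weight on one of them. -/
lemma exists_interaction_le {d m : ℕ} {p q : ℕ} {r : ℝ} (hp : 2 < p) (hr : 0 < r)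
    (hpq : 1 ≤ ((p : ℝ) - 2) * ((q : ℝ) / r - 1)) {c₁ c₂ : ℝ} (hc₁ : 0 ≤ c₁) (hc₂ : 0 ≤ c₂)
    {ε : ℝ} (hε : 0 < ε) :
    ∃ C : ℝ, 0 ≤ C ∧ ∀ s e : Finset (Pos d × Pos m),
      c₁ * (s.card * e.card) + c₂ * (e.card * ∑ u ∈ s, ‖u.2‖ ^ r + s.card * ∑ v ∈ e, ‖v.2‖ ^ r) ≤
        ε * finsetLyapunov p q e + C * finsetLyapunov p q s := by
  -- `δ` is the weight in the spin terms, `δ'` the one in the particle numbers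
  set δ := ε / (c₂ + 1) with hδ
  have hδ0 : 0 < δ := by positivity
  have hδε : c₂ * δ ≤ ε := by
    rw [hδ, mul_div_assoc', div_le_iff₀ (by positivity)]; nlinarith
  obtain ⟨C₁, hC₁, h1⟩ := exists_natCast_mul_rpow_le hp hr hpq hδ0
  set δ' := ε / (c₁ + 2 * (c₂ * C₁) + 1) with hδ'
  have hδ'0 : 0 < δ' := by positivity
  have hδ'ε : (c₁ + 2 * (c₂ * C₁)) * δ' ≤ ε := by
    have : 0 ≤ c₂ * C₁ := by positivity
    rw [hδ', mul_div_assoc', div_le_iff₀ (by positivity)]; nlinarith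
  obtain ⟨C₂, hC₂, h2⟩ := exists_mul_pow_le hp hδ'0
  refine ⟨ε + (c₁ + 2 * (c₂ * C₁)) * C₂, by positivity, fun s e => ?_⟩
  have hsum : ∀ s e : Finset (Pos d × Pos m), (e.card : ℝ) * ∑ u ∈ s, ‖u.2‖ ^ r ≤
      δ * ∑ u ∈ s, ‖u.2‖ ^ q + C₁ * (s.card * (e.card : ℝ) ^ (p - 1)) := by
    intro s e
    calc (e.card : ℝ) * ∑ u ∈ s, ‖u.2‖ ^ r = ∑ u ∈ s, (e.card : ℝ) * ‖u.2‖ ^ r :=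
          Finset.mul_sum _ _ _
      _ ≤ ∑ u ∈ s, (δ * ‖u.2‖ ^ q + C₁ * (e.card : ℝ) ^ (p - 1)) :=
          Finset.sum_le_sum fun u _ => h1 _ _ (norm_nonneg _)
      _ = _ := by
          rw [Finset.sum_add_distrib, ← Finset.mul_sum, Finset.sum_const, nsmul_eq_mul]; ring
  set n : ℝ := (s.card : ℝ) with hn
  set N : ℝ := (e.card : ℝ) with hN
  have hn0 : 0 ≤ n := by positivity
  have hN0 : 0 ≤ N := by positivity
  obtain ⟨h3, h4⟩ := h2 n N hn0 hN0
  have h5 : n * N ≤ n * N ^ (p - 1) := by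
    have : N ≤ N ^ (p - 1) := by
      rw [hN]; exact_mod_cast Nat.le_self_pow (by omega) _
    gcongr
  have h6 := hsum s e
  have h7 := hsum e s
  rw [← hn, ← hN] at h6 h7
  set S := ∑ u ∈ s, ‖u.2‖ ^ q with hS
  set T := ∑ u ∈ e, ‖u.2‖ ^ q with hT
  have hS0 : 0 ≤ S := by positivity
  have hT0 : 0 ≤ T := by positivity
  have hNp : 0 ≤ N ^ p := by positivity
  have hnp : 0 ≤ n ^ p := by positivity
  have hcC : 0 ≤ c₂ * C₁ := by positivity
  simp only [finsetLyapunov, ← hn, ← hN, ← hS, ← hT]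
  calc c₁ * (n * N) + c₂ * (N * ∑ u ∈ s, ‖u.2‖ ^ r + n * ∑ v ∈ e, ‖v.2‖ ^ r)
      ≤ c₁ * (δ' * N ^ p + C₂ * n ^ p) +
          c₂ * ((δ * S + C₁ * (δ' * N ^ p + C₂ * n ^ p)) +
            (δ * T + C₁ * (δ' * N ^ p + C₂ * n ^ p))) := by
        gcongr
        · linarith
        · exact h6.trans (by gcongr)
        · exact h7.trans (by gcongr)
    _ = (c₁ + 2 * (c₂ * C₁)) * δ' * N ^ p + (c₁ + 2 * (c₂ * C₁)) * C₂ * n ^ p +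
          c₂ * δ * T + c₂ * δ * S := by ring
    _ ≤ ε * N ^ p + (c₁ + 2 * (c₂ * C₁)) * C₂ * n ^ p + ε * T + ε * S := by gcongr
    _ ≤ _ := by
        have h8 : 0 ≤ (c₁ + 2 * (c₂ * C₁)) * C₂ * S := by positivity
        have h9 : 0 ≤ ε * n ^ p := by positivity
        nlinarith

/-- The single-spin measure has exponential moments of every order below the growth of `V`. -/
lemma lintegral_exp_spinMeasure_lt_top {d m : ℕ} {U : Potentials d m} {P r : ℝ} {qV : ℕ}
    (hU : U.Admissible P r qV) {q : ℕ} (hq : q < qV) (hqV : 1 < qV) (c : ℝ) :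
    ∫⁻ s, ENNReal.ofReal (Real.exp (c * ‖s‖ ^ q)) ∂U.spinMeasure < ∞ := by
  obtain ⟨a, b, ha, hb, hV⟩ := hU.V_bound
  obtain ⟨C₁, -, h1⟩ := exists_mul_rpow_le (Nat.cast_nonneg q) (Nat.cast_lt (α := ℝ).2 hq) c
    (half_pos ha)
  obtain ⟨C₂, -, h2⟩ := exists_mul_rpow_le zero_le_one
    (show (1 : ℝ) < (qV : ℝ) by exact_mod_cast hqV) ((m : ℝ) + 1) (half_pos ha)
  have hm : ∫⁻ s, ENNReal.ofReal (Real.exp (c * ‖s‖ ^ q)) ∂U.spinMeasure =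
      ∫⁻ s : Pos m, ENNReal.ofReal (Real.exp (-U.V s)) *
        ENNReal.ofReal (Real.exp (c * ‖s‖ ^ q)) := by
    have := hU.V_meas
    exact lintegral_withDensity_eq_lintegral_mul _ (by fun_prop) (by fun_prop)
  rw [hm]
  have hfin : ∫⁻ s : Pos m, ENNReal.ofReal ((1 + ‖s‖) ^ (-((m : ℝ) + 1))) < ∞ :=
    finite_integral_one_add_norm (by rw [finrank_euclideanSpace_fin]; linarith)
  calc ∫⁻ s : Pos m, ENNReal.ofReal (Real.exp (-U.V s)) *
        ENNReal.ofReal (Real.exp (c * ‖s‖ ^ q))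
      ≤ ∫⁻ s : Pos m, ENNReal.ofReal (Real.exp (C₁ + C₂ + b)) *
          ENNReal.ofReal ((1 + ‖s‖) ^ (-((m : ℝ) + 1))) := by
        refine lintegral_mono fun s => ?_
        rw [← ENNReal.ofReal_mul (Real.exp_nonneg _), ← ENNReal.ofReal_mul (Real.exp_nonneg _)]
        refine ENNReal.ofReal_le_ofReal ?_
        have hs := norm_nonneg s
        have e1 := h1 _ hs
        have e2 := h2 _ hs
        have e3 := hV s
        rw [Real.rpow_natCast, Real.rpow_natCast] at e1
        rw [Real.rpow_natCast, Real.rpow_one] at e2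
        have hlog : Real.log (1 + ‖s‖) ≤ ‖s‖ := by
          have := Real.log_le_sub_one_of_pos (show 0 < 1 + ‖s‖ by positivity)
          linarith
        rw [Real.rpow_def_of_pos (by positivity), ← Real.exp_add, ← Real.exp_add]
        refine Real.exp_le_exp.2 ?_
        have := mul_le_mul_of_nonneg_left hlog (show 0 ≤ (m : ℝ) + 1 by positivity)
        linarith
    _ = ENNReal.ofReal (Real.exp (C₁ + C₂ + b)) *
          ∫⁻ s : Pos m, ENNReal.ofReal ((1 + ‖s‖) ^ (-((m : ℝ) + 1))) :=
        lintegral_const_mul' _ _ ENNReal.ofReal_ne_top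
    _ < ∞ := ENNReal.mul_lt_top ENNReal.ofReal_lt_top hfin

lemma isFiniteMeasure_spinMeasure {d m : ℕ} {U : Potentials d m} {P r : ℝ} {qV : ℕ}
    (hU : U.Admissible P r qV) (hqV : 1 < qV) : IsFiniteMeasure U.spinMeasure := by
  refine ⟨?_⟩
  have := lintegral_exp_spinMeasure_lt_top hU (q := 0) (by omega) hqV 0
  simpa using this

/-! ### Pair sums and the decomposition of the energy -/

section Sums

variable {α M : Type*} [AddCommMonoid M]

/-- The sum of `f` over the ordered pairs of distinct elements of `s`. -/
noncomputable def pairSum (f : α → α → M) (s : Set α) : M := ∑ᶠ u ∈ s, ∑ᶠ v ∈ s \ {u}, f u v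

/-- The sum of `f` over `s × t`. -/
noncomputable def crossSum (f : α → α → M) (s t : Set α) : M := ∑ᶠ u ∈ s, ∑ᶠ v ∈ t, f u v

lemma pairSum_coe [DecidableEq α] (f : α → α → M) (s : Finset α) :
    pairSum f (s : Set α) = ∑ u ∈ s, ∑ v ∈ s.erase u, f u v := by
  rw [pairSum, finsum_mem_coe_finset]
  refine Finset.sum_congr rfl fun u _ => ?_
  rw [← Finset.coe_erase, finsum_mem_coe_finset]

lemma crossSum_coe (f : α → α → M) (s t : Finset α) :
    crossSum f (s : Set α) (t : Set α) = ∑ u ∈ s, ∑ v ∈ t, f u v := by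
  rw [crossSum, finsum_mem_coe_finset]
  exact Finset.sum_congr rfl fun u _ => finsum_mem_coe_finset _ _

lemma pairSum_union {f : α → α → M} (hf : ∀ u v, f u v = f v u) {s t : Set α} (hs : s.Finite)
    (ht : t.Finite) (hst : Disjoint s t) :
    pairSum f (s ∪ t) = pairSum f s + pairSum f t + (crossSum f s t + crossSum f s t) := by
  classical
  lift s to Finset α using hs
  lift t to Finset α using ht
  have hst' : Disjoint s t := by exact_mod_cast hst
  rw [← Finset.coe_union, pairSum_coe, pairSum_coe, pairSum_coe, crossSum_coe,
    Finset.sum_union hst']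
  have h1 : ∀ u ∈ s, ∑ v ∈ (s ∪ t).erase u, f u v = ∑ v ∈ s.erase u, f u v + ∑ v ∈ t, f u v := by
    intro u hu
    have hut : u ∉ t := Finset.disjoint_left.1 hst' hu
    rw [Finset.erase_union_distrib, Finset.erase_eq_of_notMem hut,
      Finset.sum_union (hst'.mono_left (Finset.erase_subset _ _))]
  have h2 : ∀ u ∈ t, ∑ v ∈ (s ∪ t).erase u, f u v = ∑ v ∈ s, f v u + ∑ v ∈ t.erase u, f u v := by
    intro u hu
    have hus : u ∉ s := Finset.disjoint_right.1 hst' hu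
    rw [Finset.erase_union_distrib, Finset.erase_eq_of_notMem hus,
      Finset.sum_union (hst'.mono_right (Finset.erase_subset _ _))]
    congr 1
    exact Finset.sum_congr rfl fun v _ => hf _ _
  rw [Finset.sum_congr rfl h1, Finset.sum_congr rfl h2, Finset.sum_add_distrib,
    Finset.sum_add_distrib, Finset.sum_comm (s := t) (t := s)]
  abel

lemma crossSum_union_left {f : α → α → M} {s s' : Set α} (hs : s.Finite) (hs' : s'.Finite)
    (h : Disjoint s s') (t : Set α) :
    crossSum f (s ∪ s') t = crossSum f s t + crossSum f s' t :=
  finsum_mem_union h hs hs'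

lemma crossSum_union_right {f : α → α → M} {s t t' : Set α} (hs : s.Finite) (h : Disjoint t t')
    (ht : ∀ u ∈ s, (t ∩ Function.support (f u)).Finite)
    (ht' : ∀ u ∈ s, (t' ∩ Function.support (f u)).Finite) :
    crossSum f s (t ∪ t') = crossSum f s t + crossSum f s t' := by
  rw [crossSum, crossSum, crossSum, ← finsum_mem_add_distrib hs]
  exact finsum_mem_congr rfl fun u hu => finsum_mem_union' h (ht u hu) (ht' u hu)

lemma crossSum_eq_of_support {f : α → α → M} {s t t' : Set α} (htt' : t' ⊆ t)
    (h : ∀ u ∈ s, ∀ v ∈ t, v ∉ t' → f u v = 0) : crossSum f s t = crossSum f s t' := by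
  refine finsum_mem_congr rfl fun u hu => ?_
  refine finsum_mem_inter_support_eq _ _ _ ?_
  ext v
  constructor
  · rintro ⟨hv, hv'⟩
    exact ⟨by by_contra h'; exact hv' (h u hu v hv h'), hv'⟩
  · rintro ⟨hv, hv'⟩
    exact ⟨htt' hv, hv'⟩

end Sums

variable {d m : ℕ}

/-- The positional interaction as a function of marked points. -/
def Potentials.posInt (U : Potentials d m) (u v : Pos d × Pos m) : EReal := U.Φ u.1 v.1

/-- The spin interaction as a function of marked points. -/
def Potentials.spinInt (U : Potentials d m) (u v : Pos d × Pos m) : ℝ := U.J u.1 v.1 * U.W u.2 v.2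

lemma posEnergy_eq (U : Potentials d m) (γ : MarkedConf d m) :
    U.posEnergy γ.positions = ((1 / 2 : ℝ) : EReal) * pairSum U.posInt γ.carrier := by
  rw [Potentials.posEnergy, positions, finsum_mem_image γ.injOn, pairSum]
  congr 1
  refine finsum_mem_congr rfl fun u hu => ?_
  have : Prod.fst '' γ.carrier \ {u.1} = Prod.fst '' (γ.carrier \ {u}) := by
    ext x
    constructor
    · rintro ⟨⟨v, hv, rfl⟩, hne⟩
      exact ⟨v, ⟨hv, fun h => hne (congrArg Prod.fst h)⟩, rfl⟩
    · rintro ⟨v, ⟨hv, hne⟩, rfl⟩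
      exact ⟨⟨v, hv, rfl⟩, fun h => hne (γ.injOn hv hu h)⟩
  rw [this, finsum_mem_image (γ.injOn.mono Set.sdiff_subset)]
  rfl

lemma condPosEnergy_eq (U : Potentials d m) (Δ : Set (Pos d)) (η γ : MarkedConf d m) :
    U.condPosEnergy Δ η γ =
      ((1 / 2 : ℝ) : EReal) * pairSum U.posInt (γ.restrict Δ).carrier +
        crossSum U.posInt (γ.restrict Δ).carrier (η.restrict Δᶜ).carrier := by
  rw [Potentials.condPosEnergy, posEnergy_eq, positions, finsum_mem_image (MarkedConf.injOn _)]
  congr 1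
  refine finsum_mem_congr rfl fun u _ => ?_
  rw [positions, finsum_mem_image (MarkedConf.injOn _)]
  rfl

lemma condSpinEnergy_eq (U : Potentials d m) (Δ : Set (Pos d)) (η γ : MarkedConf d m) :
    U.condSpinEnergy Δ η γ =
      (1 / 2 : ℝ) * pairSum U.spinInt (γ.restrict Δ).carrier +
        crossSum U.spinInt (γ.restrict Δ).carrier (η.restrict Δᶜ).carrier := rfl

/-- The interaction of the particles in `A` among each other and with the configuration `η`. -/
noncomputable def Potentials.localEnergy (U : Potentials d m) (A : Set (Pos d))
    (η γ : MarkedConf d m) : EReal :=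
  (((1 / 2 : ℝ) : EReal) * pairSum U.posInt (γ.restrict A).carrier +
    crossSum U.posInt (γ.restrict A).carrier η.carrier) +
  (((1 / 2 : ℝ) * pairSum U.spinInt (γ.restrict A).carrier +
    crossSum U.spinInt (γ.restrict A).carrier η.carrier : ℝ) : EReal)

lemma finite_inter_support_of_finite_range {M : Type*} [Zero M]
    {f : Pos d × Pos m → Pos d × Pos m → M} {R : ℝ}
    (hf : ∀ u v, R ≤ ‖u.1 - v.1‖ → f u v = 0) (η : MarkedConf d m) (u : Pos d × Pos m) :
    (η.carrier ∩ Function.support (f u)).Finite := by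
  refine (η.finite_of_isCompact _ (isCompact_closedBall u.1 R)).subset fun v hv => ⟨hv.1, ?_⟩
  by_contra h
  rw [Metric.mem_closedBall, dist_comm, dist_eq_norm, not_le] at h
  exact hv.2 (hf u v h.le)

/-- Removing the particles in `A ⊆ Δ` changes the energy by their local energy. -/
lemma condEnergy_eq_add_localEnergy (U : Potentials d m) {P r : ℝ} {qV : ℕ}
    (hU : U.Admissible P r qV) {A Δ : Set (Pos d)} (hAΔ : A ⊆ Δ) (hΔ : Bornology.IsBounded Δ)
    (ζ γ : MarkedConf d m) :
    U.condEnergy Δ ζ γ = U.condEnergy Δ ζ (γ.restrict Aᶜ) +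
      U.localEnergy A (glue Δ ζ (γ.restrict Aᶜ)) γ := by
  obtain ⟨R, hR, hrange⟩ := hU.finite_range
  have hpos : ∀ u v, R ≤ ‖u.1 - v.1‖ → U.posInt u v = 0 := fun u v h => (hrange _ _ h).1
  have hspin : ∀ u v, R ≤ ‖u.1 - v.1‖ → U.spinInt u v = 0 := fun u v h => by
    rw [Potentials.spinInt, (hrange _ _ h).2, zero_mul]
  set s := (γ.restrict A).carrier with hs
  set s' := ((γ.restrict Aᶜ).restrict Δ).carrier with hs'
  set t := (ζ.restrict Δᶜ).carrier with ht
  have hsfin : s.Finite := restrict_finite (hΔ.subset hAΔ) γ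
  have hs'fin : s'.Finite := restrict_finite hΔ _
  have hsplit : (γ.restrict Δ).carrier = s ∪ s' := by
    ext u
    have := @hAΔ u.1
    simp only [hs, hs', mem_restrict, Set.mem_union, Set.mem_compl_iff]; tauto
  have hdisj : Disjoint s s' := by
    rw [Set.disjoint_left]
    intro u hu hu'
    exact hu'.1.2 hu.2
  have hdisj' : Disjoint s' t := by
    rw [Set.disjoint_left]
    intro u hu hu'
    exact hu'.2 hu.2
  have hglue : (glue Δ ζ (γ.restrict Aᶜ)).carrier = s' ∪ t := rfl
  have key : ∀ {M : Type} [AddCommMonoid M] {f : Pos d × Pos m → Pos d × Pos m → M},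
      (∀ u v, f u v = f v u) → (∀ u v, R ≤ ‖u.1 - v.1‖ → f u v = 0) →
      pairSum f (s ∪ s') = pairSum f s + pairSum f s' + (crossSum f s s' + crossSum f s s') ∧
      crossSum f (s ∪ s') t = crossSum f s t + crossSum f s' t ∧
      crossSum f s (s' ∪ t) = crossSum f s s' + crossSum f s t := by
    intro M _ f hsymm hf
    refine ⟨pairSum_union hsymm hsfin hs'fin hdisj, crossSum_union_left hsfin hs'fin hdisj _,
      crossSum_union_right hsfin hdisj' (fun u _ => hs'fin.subset Set.inter_subset_left)
        fun u _ => ?_⟩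
    exact finite_inter_support_of_finite_range hf (ζ.restrict Δᶜ) u
  obtain ⟨a1, a2, a3⟩ := key (f := U.posInt) (fun u v => hU.Φ_symm _ _) hpos
  obtain ⟨b1, b2, b3⟩ := key (f := U.spinInt)
    (fun u v => by rw [Potentials.spinInt, Potentials.spinInt, hU.J_symm, hU.W_symm]) hspin
  have hhalf : ∀ x : EReal, ((1 / 2 : ℝ) : EReal) * (x + x) = x := fun x => by
    rw [EReal.left_distrib_of_nonneg_of_ne_top (by positivity) (EReal.coe_ne_top _),
      ← EReal.right_distrib_of_nonneg (by positivity) (by positivity), ← EReal.coe_add]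
    norm_num
  rw [Potentials.condEnergy, Potentials.condEnergy, Potentials.localEnergy, condPosEnergy_eq,
    condPosEnergy_eq, condSpinEnergy_eq, condSpinEnergy_eq, hsplit, hglue, ← hs, ← hs', ← ht,
    a1, a2, a3, b1, b2, b3]
  have hdist : ∀ x y : EReal, ((1 / 2 : ℝ) : EReal) * (x + y) =
      ((1 / 2 : ℝ) : EReal) * x + ((1 / 2 : ℝ) : EReal) * y := fun x y =>
    EReal.left_distrib_of_nonneg_of_ne_top (by positivity) (EReal.coe_ne_top _) _ _
  rw [hdist, hdist, hhalf]
  have hreal : ∀ a b c x y : ℝ, (1 / 2 : ℝ) * (a + b + (c + c)) + (x + y) =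
      (1 / 2 * b + y) + (1 / 2 * a + (c + x)) := fun a b c x y => by ring
  rw [hreal, EReal.coe_add]
  abel

/-! ### The lower bound on the local energy -/

lemma coe_sum_ereal {ι : Type*} (s : Finset ι) (f : ι → ℝ) :
    ((∑ i ∈ s, f i : ℝ) : EReal) = ∑ i ∈ s, (f i : EReal) := by
  classical
  induction s using Finset.induction_on with
  | empty => simp
  | insert i s hi ih => rw [Finset.sum_insert hi, Finset.sum_insert hi, EReal.coe_add, ih]

lemma posInt_ge {U : Potentials d m} {P B A : ℝ}
    (hsymm : ∀ x y, U.Φ x y = U.Φ y x) (hA : 0 < A)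
    (hss : ∀ γ : Set (Pos d), γ.Finite →
      ((A * ∑ᶠ k : Fin d → ℤ, ((γ ∩ cube k).ncard : ℝ) ^ P - B * (γ.ncard : ℝ) : ℝ) : EReal)
        ≤ U.posEnergy γ) {x y : Pos d} (hxy : x ≠ y) :
    ((-(2 * B) : ℝ) : EReal) ≤ U.Φ x y := by
  classical
  have h := hss {x, y} (Set.toFinite _)
  have h1 : U.posEnergy {x, y} = U.Φ x y := by
    have hp : U.posEnergy {x, y} = ((1 / 2 : ℝ) : EReal) *
        pairSum U.Φ ((({x, y} : Finset (Pos d)) : Set (Pos d))) := by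
      rw [Finset.coe_pair]; rfl
    rw [hp, pairSum_coe, Finset.sum_pair hxy]
    have e1 : ({x, y} : Finset (Pos d)).erase x = {y} := by
      ext v; simp only [Finset.mem_erase, Finset.mem_insert, Finset.mem_singleton]; grind
    have e2 : ({x, y} : Finset (Pos d)).erase y = {x} := by
      ext v; simp only [Finset.mem_erase, Finset.mem_insert, Finset.mem_singleton]; grind
    rw [e1, e2, Finset.sum_singleton, Finset.sum_singleton, hsymm y x,
      EReal.left_distrib_of_nonneg_of_ne_top (by positivity) (EReal.coe_ne_top _),
      ← EReal.right_distrib_of_nonneg (by positivity) (by positivity), ← EReal.coe_add]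
    norm_num
  rw [h1, Set.ncard_pair hxy] at h
  refine le_trans (EReal.coe_le_coe_iff.2 ?_) h
  have : 0 ≤ ∑ᶠ k : Fin d → ℤ, ((({x, y} : Set (Pos d)) ∩ cube k).ncard : ℝ) ^ P :=
    finsum_nonneg fun k => by positivity
  have := mul_nonneg hA.le this
  push_cast
  linarith

/-- The points of a configuration in a bounded set as a finite set. -/
noncomputable def MarkedConf.pts (γ : MarkedConf d m) {Δ : Set (Pos d)}
    (hΔ : Bornology.IsBounded Δ) : Finset (Pos d × Pos m) :=
  (restrict_finite hΔ γ).toFinset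

@[simp] lemma MarkedConf.mem_pts {γ : MarkedConf d m} {Δ : Set (Pos d)}
    {hΔ : Bornology.IsBounded Δ} {u : Pos d × Pos m} :
    u ∈ γ.pts hΔ ↔ u ∈ γ.carrier ∧ u.1 ∈ Δ := by
  rw [MarkedConf.pts, Set.Finite.mem_toFinset, mem_restrict]

lemma MarkedConf.coe_pts (γ : MarkedConf d m) {Δ : Set (Pos d)} (hΔ : Bornology.IsBounded Δ) :
    (γ.pts hΔ : Set (Pos d × Pos m)) = (γ.restrict Δ).carrier :=
  (restrict_finite hΔ γ).coe_toFinset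

lemma MarkedConf.finsetLyapunov_pts (p q : ℕ) (γ : MarkedConf d m) {Δ : Set (Pos d)}
    (hΔ : Bornology.IsBounded Δ) :
    finsetLyapunov p q (γ.pts hΔ) = lyapunov p q (γ.restrict Δ) := by
  rw [lyapunov_eq, ← coe_pts γ hΔ, Set.ncard_coe_finset, finsum_mem_coe_finset, finsetLyapunov]

lemma sum_sum_spin (s e : Finset (Pos d × Pos m)) (r C : ℝ) :
    ∑ u ∈ s, ∑ v ∈ e, (‖u.2‖ ^ r + ‖v.2‖ ^ r + C) =
      (e.card * ∑ u ∈ s, ‖u.2‖ ^ r + s.card * ∑ v ∈ e, ‖v.2‖ ^ r) + C * (s.card * e.card) := by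
  simp only [Finset.sum_add_distrib, Finset.sum_const, nsmul_eq_mul, Finset.mul_sum]
  ring

/-- The particles in one cube, interacting among each other and with a configuration `η` outside,
have an energy that beats `a F(γ_k)` up to spin terms and an arbitrarily small multiple of the
functional `F` of `η` in the nearby cubes. -/
theorem exists_localEnergy_ge {U : Potentials d m} {P r : ℝ} {qV : ℕ}
    (hU : U.Admissible P r qV) {p q : ℕ} (hp : 2 < p) (hpP : (p : ℝ) < P)
    (hpq : 1 ≤ ((p : ℝ) - 2) * ((q : ℝ) / r - 1)) {β : ℝ} (hβ : 0 < β) :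
    ∃ M : ℕ, ∀ a ε : ℝ, 0 < ε → ∃ C c : ℝ, ∀ (k : Fin d → ℤ) (η γ : MarkedConf d m),
      (η.restrict (cube k)).carrier = ∅ →
      ∃ D : ℝ, (D : EReal) ≤ U.localEnergy (cube k) η γ ∧
        a * lyapunov p q (γ.restrict (cube k)) - β * D ≤
          C + c * ∑ᶠ u ∈ (γ.restrict (cube k)).carrier, ‖u.2‖ ^ q +
            ε * ∑ j ∈ nearby M k, lyapunov p q (η.restrict (cube j)) := by
  classical
  obtain ⟨R, hR, hrange⟩ := hU.finite_range
  obtain ⟨A, B, hA, hB, hss⟩ := hU.superstable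
  obtain ⟨CJ, hJ⟩ := hU.J_bdd
  obtain ⟨CW, hW⟩ := hU.W_bound
  have hP0 : P ≠ 0 := by have := hU.two_lt_P; linarith
  have hCJ : 0 ≤ CJ := (abs_nonneg _).trans (hJ 0 0)
  set CW' := max CW 0 with hCW'
  have hCW0 : 0 ≤ CW' := le_max_right _ _
  obtain ⟨M, hM⟩ := exists_nat_ge R
  refine ⟨M, fun a ε hε => ?_⟩
  have hβε : 0 < ε / β := by positivity
  -- interaction of the cube with the surroundings, and inside the cube
  obtain ⟨C₁, hC₁, h1⟩ := exists_interaction_le (d := d) (m := m) hp hU.r_pos hpq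
    (c₁ := 2 * B + CJ * CW') (c₂ := CJ) (by positivity) hCJ hβε
  obtain ⟨C₂, hC₂, h2⟩ := exists_interaction_le (d := d) (m := m) hp hU.r_pos hpq
    (c₁ := CJ * CW') (c₂ := CJ) (by positivity) hCJ one_pos
  set L : ℝ := (((2 * M + 1) ^ d : ℕ) : ℝ) with hL
  set c := |a| + β * (B + (1 + C₂) + L * C₁) with hc
  have hc0 : 0 ≤ c := by positivity
  obtain ⟨C₃, -, h3⟩ := exists_mul_rpow_le (Nat.cast_nonneg p) hpP c
    (show 0 < β * A by positivity)
  refine ⟨C₃, c, fun k η γ hηk => ?_⟩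
  set s := γ.pts (isBounded_cube k) with hs
  have hscar : (γ.restrict (cube k)).carrier = (s : Set (Pos d × Pos m)) :=
    (γ.coe_pts (isBounded_cube k)).symm
  let e : (Fin d → ℤ) → Finset (Pos d × Pos m) := fun j => η.pts (isBounded_cube j)
  let E : Finset (Pos d × Pos m) := (nearby M k).biUnion e
  have hE : ∀ v, v ∈ E ↔ v ∈ η.carrier ∧ cubeIndex v.1 ∈ nearby M k := by
    intro v
    simp only [E, e, Finset.mem_biUnion, mem_pts, mem_cube_iff]
    constructor
    · rintro ⟨j, hj, hv, rfl⟩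
      exact ⟨hv, hj⟩
    · rintro ⟨hv, hj⟩
      exact ⟨_, hj, hv, rfl⟩
  have hdisj : ((nearby M k : Finset (Fin d → ℤ)) : Set (Fin d → ℤ)).PairwiseDisjoint e := by
    intro i _ j _ hij
    refine Finset.disjoint_left.2 fun v hv hv' => ?_
    exact Set.disjoint_left.1 (disjoint_cube hij) (mem_pts.1 hv).2 (mem_pts.1 hv').2
  have hne : ∀ u ∈ s, ∀ v ∈ E, u.1 ≠ v.1 := by
    intro u hu v hv huv
    have : v ∈ (η.restrict (cube k)).carrier :=
      ⟨((hE v).1 hv).1, huv ▸ (mem_pts.1 hu).2⟩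
    rw [hηk] at this
    exact this
  have hfar : ∀ u ∈ (s : Set (Pos d × Pos m)), ∀ v ∈ η.carrier, v ∉ (E : Set (Pos d × Pos m)) →
      R ≤ ‖u.1 - v.1‖ := by
    intro u hu v hv hvE
    by_contra! h
    refine hvE ((hE v).2 ⟨hv, ?_⟩)
    have hu' : cubeIndex u.1 = k := mem_cube_iff.1 (mem_pts.1 hu).2
    rw [← hu']
    exact mem_nearby_of_norm_lt (h.trans_le hM)
  have hEsub : (E : Set (Pos d × Pos m)) ⊆ η.carrier := fun v hv => ((hE v).1 hv).1
  have hcross : crossSum U.posInt (s : Set (Pos d × Pos m)) η.carrier =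
      ∑ u ∈ s, ∑ v ∈ E, U.posInt u v := by
    rw [crossSum_eq_of_support hEsub fun u hu v hv hvE =>
      show U.posInt u v = 0 from (hrange _ _ (hfar u hu v hv hvE)).1,
      crossSum_coe]
  have hcross' : crossSum U.spinInt (s : Set (Pos d × Pos m)) η.carrier =
      ∑ u ∈ s, ∑ v ∈ E, U.spinInt u v := by
    rw [crossSum_eq_of_support hEsub fun u hu v hv hvE => by
      rw [Potentials.spinInt, (hrange _ _ (hfar u hu v hv hvE)).2, zero_mul], crossSum_coe]
  -- the three contributions
  have hself : ((A * (s.card : ℝ) ^ P - B * s.card : ℝ) : EReal) ≤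
      ((1 / 2 : ℝ) : EReal) * pairSum U.posInt (s : Set (Pos d × Pos m)) := by
    have h := hss (γ.restrict (cube k)).positions
      ((restrict_finite (isBounded_cube k) γ).image _)
    rw [posEnergy_eq, hscar, ncard_positions, hscar, Set.ncard_coe_finset] at h
    have hsum : ∑ᶠ j : Fin d → ℤ, (((γ.restrict (cube k)).positions ∩ cube j).ncard : ℝ) ^ P =
        (s.card : ℝ) ^ P := by
      rw [finsum_eq_single _ k]
      · have : (γ.restrict (cube k)).positions ∩ cube k = (γ.restrict (cube k)).positions := by
          rw [Set.inter_eq_left]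
          rintro _ ⟨v, hv, rfl⟩
          exact hv.2
        rw [this, ncard_positions, hscar, Set.ncard_coe_finset]
      · intro j hj
        have : (γ.restrict (cube k)).positions ∩ cube j = ∅ := by
          rw [Set.eq_empty_iff_forall_notMem]
          rintro _ ⟨⟨v, hv, rfl⟩, hvj⟩
          exact Set.disjoint_left.1 (disjoint_cube hj) hvj hv.2
        rw [this, Set.ncard_empty, Nat.cast_zero, Real.zero_rpow hP0]
    rwa [hsum] at h
  have hposcross : ((∑ _u ∈ s, ∑ _v ∈ E, (-(2 * B)) : ℝ) : EReal) ≤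
      ∑ u ∈ s, ∑ v ∈ E, U.posInt u v := by
    simp only [coe_sum_ereal]
    exact Finset.sum_le_sum fun u hu => Finset.sum_le_sum fun v hv =>
      posInt_ge hU.Φ_symm hA hss (hne u hu v hv)
  have habs : ∀ u v, |U.spinInt u v| ≤ CJ * (‖u.2‖ ^ r + ‖v.2‖ ^ r + CW') := by
    intro u v
    rw [Potentials.spinInt, abs_mul]
    have := le_max_left CW 0
    exact mul_le_mul (hJ _ _) ((hW _ _).trans (by linarith)) (abs_nonneg _) hCJ
  have hF0 := finsetLyapunov_nonneg p q s
  have hspinself : |(1 / 2 : ℝ) * pairSum U.spinInt (s : Set (Pos d × Pos m))| ≤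
      (1 + C₂) * finsetLyapunov p q s := by
    have h := h2 s s
    rw [pairSum_coe]
    have h4 : |∑ u ∈ s, ∑ v ∈ s.erase u, U.spinInt u v| ≤
        ∑ u ∈ s, ∑ v ∈ s, CJ * (‖u.2‖ ^ r + ‖v.2‖ ^ r + CW') := by
      refine (Finset.abs_sum_le_sum_abs _ _).trans (Finset.sum_le_sum fun u _ => ?_)
      refine (Finset.abs_sum_le_sum_abs _ _).trans ?_
      refine (Finset.sum_le_sum fun v _ => habs u v).trans ?_
      exact Finset.sum_le_sum_of_subset_of_nonneg (Finset.erase_subset _ _)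
        fun v _ _ => by positivity
    simp only [← Finset.mul_sum] at h4
    rw [sum_sum_spin] at h4
    rw [abs_mul, abs_of_pos (by norm_num : (0 : ℝ) < 1 / 2)]
    have := abs_nonneg (∑ u ∈ s, ∑ v ∈ s.erase u, U.spinInt u v)
    nlinarith
  have hcrosstot : ∑ u ∈ s, ∑ v ∈ E, (2 * B) + |∑ u ∈ s, ∑ v ∈ E, U.spinInt u v| ≤
      L * (C₁ * finsetLyapunov p q s) + ε / β * ∑ j ∈ nearby M k, finsetLyapunov p q (e j) := by
    have h4 : |∑ u ∈ s, ∑ v ∈ E, U.spinInt u v| ≤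
        ∑ u ∈ s, ∑ v ∈ E, CJ * (‖u.2‖ ^ r + ‖v.2‖ ^ r + CW') :=
      (Finset.abs_sum_le_sum_abs _ _).trans (Finset.sum_le_sum fun u _ =>
        (Finset.abs_sum_le_sum_abs _ _).trans (Finset.sum_le_sum fun v _ => habs u v))
    calc ∑ u ∈ s, ∑ v ∈ E, (2 * B) + |∑ u ∈ s, ∑ v ∈ E, U.spinInt u v|
        ≤ ∑ u ∈ s, ∑ v ∈ E, (2 * B) + ∑ u ∈ s, ∑ v ∈ E, CJ * (‖u.2‖ ^ r + ‖v.2‖ ^ r + CW') := by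
          gcongr
      _ = ∑ v ∈ E, ∑ u ∈ s, (2 * B + CJ * (‖u.2‖ ^ r + ‖v.2‖ ^ r + CW')) := by
          rw [← Finset.sum_add_distrib, Finset.sum_comm]
          refine Finset.sum_congr rfl fun u _ => ?_
          simp only [Finset.sum_add_distrib]
      _ = ∑ j ∈ nearby M k, ∑ v ∈ e j, ∑ u ∈ s,
            (2 * B + CJ * (‖u.2‖ ^ r + ‖v.2‖ ^ r + CW')) := Finset.sum_biUnion hdisj
      _ ≤ ∑ j ∈ nearby M k,
            (ε / β * finsetLyapunov p q (e j) + C₁ * finsetLyapunov p q s) := by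
          refine Finset.sum_le_sum fun j _ => ?_
          rw [Finset.sum_comm]
          have hsplit : ∑ u ∈ s, ∑ v ∈ e j, (2 * B + CJ * (‖u.2‖ ^ r + ‖v.2‖ ^ r + CW')) =
              ∑ u ∈ s, ∑ v ∈ e j, (2 * B) +
                CJ * ∑ u ∈ s, ∑ v ∈ e j, (‖u.2‖ ^ r + ‖v.2‖ ^ r + CW') := by
            rw [Finset.mul_sum, ← Finset.sum_add_distrib]
            refine Finset.sum_congr rfl fun u _ => ?_
            rw [Finset.mul_sum, ← Finset.sum_add_distrib]
          rw [hsplit, sum_sum_spin]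
          refine le_trans (le_of_eq ?_) (h1 s (e j))
          simp only [Finset.sum_const, nsmul_eq_mul]
          ring
      _ = _ := by
          rw [Finset.sum_add_distrib, Finset.sum_const, card_nearby, nsmul_eq_mul,
            ← Finset.mul_sum, hL]
          ring
  refine ⟨(A * (s.card : ℝ) ^ P - B * s.card + ∑ _u ∈ s, ∑ _v ∈ E, (-(2 * B))) +
    ((1 / 2 : ℝ) * pairSum U.spinInt (s : Set (Pos d × Pos m)) +
      ∑ u ∈ s, ∑ v ∈ E, U.spinInt u v), ?_, ?_⟩
  · rw [Potentials.localEnergy, hscar, hcross, hcross', EReal.coe_add, EReal.coe_add]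
    gcongr
  · have hlyap : lyapunov p q (γ.restrict (cube k)) = finsetLyapunov p q s :=
      (finsetLyapunov_pts p q γ _).symm
    have hlyap' : ∀ j, lyapunov p q (η.restrict (cube j)) = finsetLyapunov p q (e j) := fun j =>
      (finsetLyapunov_pts p q η _).symm
    simp only [hlyap, hlyap', hscar]
    rw [finsum_mem_coe_finset]
    have h3' := h3 s.card (Nat.cast_nonneg _)
    rw [Real.rpow_natCast] at h3'
    have hn : (s.card : ℝ) ≤ finsetLyapunov p q s := by
      have h5 : (s.card : ℝ) ≤ (s.card : ℝ) ^ p := by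
        exact_mod_cast Nat.le_self_pow (by omega) _
      have h6 : 0 ≤ ∑ u ∈ s, ‖u.2‖ ^ q := by positivity
      rw [finsetLyapunov]; linarith
    have hneg : ∑ _u ∈ s, ∑ _v ∈ E, (-(2 * B)) = -∑ _u ∈ s, ∑ _v ∈ E, (2 * B) := by
      simp only [Finset.sum_neg_distrib]
    rw [hneg]
    have e1 := (abs_le.1 hspinself).1
    have e2 := neg_abs_le (∑ u ∈ s, ∑ v ∈ E, U.spinInt u v)
    have e3 : B * s.card ≤ B * finsetLyapunov p q s := by gcongr
    set X := (1 / 2 : ℝ) * pairSum U.spinInt (s : Set (Pos d × Pos m))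
    set Y := ∑ u ∈ s, ∑ v ∈ E, U.spinInt u v
    set Z := ∑ _u ∈ s, ∑ _v ∈ E, (2 * B)
    set T := ∑ j ∈ nearby M k, finsetLyapunov p q (e j)
    set F := finsetLyapunov p q s with hF
    have e4 : -(B * s.card) - Z + X + Y ≥ -((B + (1 + C₂) + L * C₁) * F + ε / β * T) := by
      linarith
    have e5 : β * (-(B * s.card) - Z + X + Y) ≥
        -(β * (B + (1 + C₂) + L * C₁) * F + ε * T) := by
      have := mul_le_mul_of_nonneg_left e4 hβ.le
      have h7 : β * (-((B + (1 + C₂) + L * C₁) * F + ε / β * T)) =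
          -(β * (B + (1 + C₂) + L * C₁) * F + ε * T) := by field_simp
      linarith
    have e6 : a * F ≤ |a| * F := by gcongr; exact le_abs_self a
    have e7 : c * F = c * (s.card : ℝ) ^ p + c * ∑ u ∈ s, ‖u.2‖ ^ q := by
      rw [hF, finsetLyapunov]; ring
    have e8 : c * F = |a| * F + β * (B + (1 + C₂) + L * C₁) * F := by rw [hc]; ring
    nlinarith

/-! ### Measurability of the energy in the tuple of particles -/

namespace MarkedConf

lemma TupleMeasurable.comp {β β' : Type*} [MeasurableSpace β] [MeasurableSpace β']
    {f : MarkedConf d m → β} (hf : TupleMeasurable f) {g : β → β'} (hg : Measurable g) :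
    TupleMeasurable fun γ => g (f γ) := fun n => hg.comp (hf n)

open scoped Classical in
lemma finsum_mem_restrict_ofTuple {M : Type*} [AddCommMonoid M] {n : ℕ}
    {w : Fin n → Pos d × Pos m} (hw : w ∈ simpleTuples d m n) (Δ : Set (Pos d))
    (f : Pos d × Pos m → M) :
    ∑ᶠ u ∈ ((ofTuple w).restrict Δ).carrier, f u = ∑ i, if (w i).1 ∈ Δ then f (w i) else 0 := by
  have h : ((ofTuple w).restrict Δ).carrier =
      w '' ((Finset.univ.filter fun i => (w i).1 ∈ Δ : Finset (Fin n)) : Set (Fin n)) := by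
    ext u
    rw [mem_restrict, carrier_ofTuple hw]
    constructor
    · rintro ⟨⟨i, rfl⟩, hi⟩
      exact ⟨i, by simpa using hi, rfl⟩
    · rintro ⟨i, hi, rfl⟩
      exact ⟨⟨i, rfl⟩, by simpa using hi⟩
  rw [h, finsum_mem_image (injective_of_injective_fst hw).injOn, finsum_mem_coe_finset,
    Finset.sum_filter]

open scoped Classical in
lemma pairSum_restrict_ofTuple {M : Type*} [AddCommMonoid M] {n : ℕ}
    {w : Fin n → Pos d × Pos m} (hw : w ∈ simpleTuples d m n) (Δ : Set (Pos d))
    (f : Pos d × Pos m → Pos d × Pos m → M) :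
    pairSum f ((ofTuple w).restrict Δ).carrier =
      ∑ i, if (w i).1 ∈ Δ then
        ∑ j, (if (w j).1 ∈ Δ then (if j ≠ i then f (w i) (w j) else 0) else 0) else 0 := by
  rw [pairSum, finsum_mem_restrict_ofTuple hw]
  refine Finset.sum_congr rfl fun i _ => ?_
  congr 1
  have h : ∑ᶠ v ∈ ((ofTuple w).restrict Δ).carrier \ {w i}, f (w i) v =
      ∑ᶠ v ∈ ((ofTuple w).restrict Δ).carrier, if v ≠ w i then f (w i) v else 0 := by
    rw [finsum_mem_def, finsum_mem_def]
    refine finsum_congr fun v => ?_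
    by_cases hv : v = w i <;> simp [Set.indicator, hv]
  rw [h, finsum_mem_restrict_ofTuple hw]
  refine Finset.sum_congr rfl fun j _ => ?_
  simp only [ne_eq, (injective_of_injective_fst hw).eq_iff]

lemma tupleMeasurable_finsum {M : Type*} [AddCommMonoid M] [MeasurableSpace M] [MeasurableAdd₂ M]
    {Δ : Set (Pos d)} (hΔ : MeasurableSet Δ) {f : Pos d × Pos m → M} (hf : Measurable f) :
    TupleMeasurable fun γ : MarkedConf d m => ∑ᶠ u ∈ (γ.restrict Δ).carrier, f u := by
  classical
  intro n
  have : (fun w : simpleTuples d m n => ∑ᶠ u ∈ ((ofTuple w.1).restrict Δ).carrier, f u) =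
      fun w => ∑ i, if (w.1 i).1 ∈ Δ then f (w.1 i) else 0 :=
    funext fun w => finsum_mem_restrict_ofTuple w.2 Δ f
  rw [this]
  refine Finset.measurable_fun_sum _ fun i _ => Measurable.ite ?_ ?_ measurable_const
  · exact measurable_subtype_coe (measurable_fst_apply i hΔ)
  · exact hf.comp ((measurable_pi_apply i).comp measurable_subtype_coe)

lemma tupleMeasurable_pairSum {M : Type*} [AddCommMonoid M] [MeasurableSpace M] [MeasurableAdd₂ M]
    {Δ : Set (Pos d)} (hΔ : MeasurableSet Δ) {f : Pos d × Pos m → Pos d × Pos m → M}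
    (hf : Measurable (Function.uncurry f)) :
    TupleMeasurable fun γ : MarkedConf d m => pairSum f (γ.restrict Δ).carrier := by
  classical
  intro n
  have : (fun w : simpleTuples d m n => pairSum f ((ofTuple w.1).restrict Δ).carrier) =
      fun w => ∑ i, if (w.1 i).1 ∈ Δ then
        ∑ j, (if (w.1 j).1 ∈ Δ then (if j ≠ i then f (w.1 i) (w.1 j) else 0) else 0) else 0 :=
    funext fun w => pairSum_restrict_ofTuple w.2 Δ f
  rw [this]
  refine Finset.measurable_fun_sum _ fun i _ => Measurable.ite ?_ ?_ measurable_const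
  · exact measurable_subtype_coe (measurable_fst_apply i hΔ)
  refine Finset.measurable_fun_sum _ fun j _ => Measurable.ite ?_ ?_ measurable_const
  · exact measurable_subtype_coe (measurable_fst_apply j hΔ)
  by_cases hij : j ≠ i
  · simp only [hij, ne_eq, not_false_eq_true, if_true]
    have hij' : Measurable fun w : simpleTuples d m n => (w.1 i, w.1 j) :=
      ((measurable_pi_apply i).comp measurable_subtype_coe).prodMk
        ((measurable_pi_apply j).comp measurable_subtype_coe)
    exact hf.comp hij'
  · simp only [hij, if_false]
    exact measurable_const

lemma tupleMeasurable_crossSum {M : Type*} [AddCommMonoid M] [MeasurableSpace M]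
    [MeasurableAdd₂ M] {Δ : Set (Pos d)} (hΔ : MeasurableSet Δ) (hb : Bornology.IsBounded Δ)
    {f : Pos d × Pos m → Pos d × Pos m → M} (hf : Measurable (Function.uncurry f)) {R : ℝ}
    (hR : ∀ u v, R ≤ ‖u.1 - v.1‖ → f u v = 0) (η : MarkedConf d m) :
    TupleMeasurable fun γ : MarkedConf d m => crossSum f (γ.restrict Δ).carrier η.carrier := by
  classical
  -- only the particles of `η` within distance `R` of `Δ` contribute
  have hb' : Bornology.IsBounded (Metric.thickening R Δ) := hb.thickening
  have h : ∀ γ : MarkedConf d m, crossSum f (γ.restrict Δ).carrier η.carrier =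
      ∑ᶠ u ∈ (γ.restrict Δ).carrier, ∑ v ∈ η.pts hb', f u v := by
    intro γ
    rw [crossSum_eq_of_support (t' := (η.pts hb' : Set (Pos d × Pos m)))]
    · exact finsum_mem_congr rfl fun u _ => finsum_mem_coe_finset _ _
    · exact fun v hv => (mem_pts.1 hv).1
    · intro u hu v hv hv'
      refine hR u v ?_
      by_contra! hlt
      refine hv' (mem_pts.2 ⟨hv, Metric.mem_thickening_iff.2 ⟨u.1, hu.2, ?_⟩⟩)
      rwa [dist_comm, dist_eq_norm]
  simp only [h]
  refine tupleMeasurable_finsum hΔ (Finset.measurable_fun_sum _ fun v _ => ?_)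
  exact hf.comp (measurable_id.prodMk measurable_const)

lemma tupleMeasurable_lyapunov (p q : ℕ) {Δ : Set (Pos d)} (hΔ : MeasurableSet Δ)
    (hb : Bornology.IsBounded Δ) :
    TupleMeasurable fun γ : MarkedConf d m => lyapunov p q (γ.restrict Δ) := by
  have h : ∀ γ : MarkedConf d m, lyapunov p q (γ.restrict Δ) =
      (∑ᶠ u ∈ (γ.restrict Δ).carrier, (1 : ℝ)) ^ p +
        ∑ᶠ u ∈ (γ.restrict Δ).carrier, ‖u.2‖ ^ q := by
    intro γ
    rw [lyapunov_eq, ← coe_pts γ hb, Set.ncard_coe_finset]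
    simp only [finsum_mem_coe_finset]
    simp
  simp only [h]
  intro n
  exact ((tupleMeasurable_finsum hΔ measurable_const n).pow_const p).add
    (tupleMeasurable_finsum hΔ (by fun_prop) n)

lemma tupleMeasurable_boltzmann {U : Potentials d m} {P r : ℝ} {qV : ℕ}
    (hU : U.Admissible P r qV) (β : ℝ) {Δ : Set (Pos d)} (hΔ : MeasurableSet Δ)
    (hb : Bornology.IsBounded Δ) (η : MarkedConf d m) :
    TupleMeasurable fun γ => U.boltzmann β Δ η γ := by
  obtain ⟨R, hR, hrange⟩ := hU.finite_range
  have hpos : Measurable (Function.uncurry U.posInt) :=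
    hU.Φ_meas.comp ((measurable_fst.comp measurable_fst).prodMk
      (measurable_fst.comp measurable_snd))
  have hspin : Measurable (Function.uncurry U.spinInt) :=
    (hU.J_meas.comp ((measurable_fst.comp measurable_fst).prodMk
      (measurable_fst.comp measurable_snd))).mul
    (hU.W_meas.comp ((measurable_snd.comp measurable_fst).prodMk
      (measurable_snd.comp measurable_snd)))
  intro n
  simp only [Potentials.boltzmann, Potentials.condEnergy, condPosEnergy_eq, condSpinEnergy_eq]
  have h1 := tupleMeasurable_pairSum hΔ hpos n
  have h2 := tupleMeasurable_crossSum hΔ hb hpos (R := R) (fun u v h => (hrange _ _ h).1)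
    (η.restrict Δᶜ) n
  have h3 := tupleMeasurable_pairSum hΔ hspin n
  have h4 := tupleMeasurable_crossSum hΔ hb hspin (R := R) (fun u v h => by
    rw [Potentials.spinInt, (hrange _ _ h).2, zero_mul]) (η.restrict Δᶜ) n
  refine EReal.exp_monotone.measurable.comp (continuous_neg.measurable.comp ?_)
  exact measurable_const.mul (((measurable_const.mul h1).add h2).add
    (((measurable_const.mul h3).add h4).coe_real_ereal))

end MarkedConf

/-! ### Removing the particles of one cube -/

lemma boltzmann_le_of_localEnergy_ge {U : Potentials d m} {P r : ℝ} {qV : ℕ}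
    (hU : U.Admissible P r qV) {β : ℝ} (hβ : 0 < β) {A Δ : Set (Pos d)} (hAΔ : A ⊆ Δ)
    (hΔ : Bornology.IsBounded Δ) (ζ γ : MarkedConf d m) {D : ℝ}
    (hD : (D : EReal) ≤ U.localEnergy A (glue Δ ζ (γ.restrict Aᶜ)) γ) :
    U.boltzmann β Δ ζ γ ≤
      ENNReal.ofReal (Real.exp (-(β * D))) * U.boltzmann β Δ ζ (γ.restrict Aᶜ) := by
  have hβ' : (0 : EReal) ≤ (β : EReal) := by exact_mod_cast hβ.le
  rw [Potentials.boltzmann, Potentials.boltzmann, condEnergy_eq_add_localEnergy U hU hAΔ hΔ,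
    ← EReal.exp_coe, ← EReal.exp_add]
  refine EReal.exp_monotone ?_
  set E := U.condEnergy Δ ζ (γ.restrict Aᶜ)
  have h1 : (β : EReal) * (E + D) ≤
      β * (E + U.localEnergy A (glue Δ ζ (γ.restrict Aᶜ)) γ) := by gcongr
  refine (EReal.neg_le_neg_iff.2 h1).trans (le_of_eq ?_)
  rw [EReal.left_distrib_of_nonneg_of_ne_top hβ' (EReal.coe_ne_top _), ← EReal.coe_mul,
    EReal.neg_add (Or.inr (EReal.coe_ne_top _)) (Or.inr (EReal.coe_ne_bot _)), sub_eq_add_neg,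
    ← EReal.coe_neg, add_comm]

/-- Pointwise removal of the particles of one cube from the Boltzmann factor. -/
theorem exists_boltzmann_le {U : Potentials d m} {P r : ℝ} {qV : ℕ}
    (hU : U.Admissible P r qV) {p q : ℕ} (hp : 2 < p) (hpP : (p : ℝ) < P)
    (hpq : 1 ≤ ((p : ℝ) - 2) * ((q : ℝ) / r - 1)) {β : ℝ} (hβ : 0 < β) :
    ∃ M : ℕ, ∀ a ε : ℝ, 0 < ε → ∃ C c : ℝ, ∀ (K : Finset (Fin d → ℤ)), ∀ k ∈ K,
      ∀ ζ γ : MarkedConf d m,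
      ENNReal.ofReal (Real.exp (a * lyapunov p q (γ.restrict (cube k)))) *
          U.boltzmann β (cubes K) ζ γ ≤
        ENNReal.ofReal (Real.exp C) *
        (ENNReal.ofReal (Real.exp (c * ∑ᶠ u ∈ (γ.restrict (cube k)).carrier, ‖u.2‖ ^ q)) *
        (ENNReal.ofReal (Real.exp (ε * ∑ j ∈ nearby M k,
          lyapunov p q ((glue (cubes K) ζ (γ.restrict (cube k)ᶜ)).restrict (cube j)))) *
        U.boltzmann β (cubes K) ζ (γ.restrict (cube k)ᶜ))) := by
  obtain ⟨M, hM⟩ := exists_localEnergy_ge hU hp hpP hpq hβ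
  refine ⟨M, fun a ε hε => ?_⟩
  obtain ⟨C, c, h⟩ := hM a ε hε
  refine ⟨C, c, fun K k hk ζ γ => ?_⟩
  have hη : ((glue (cubes K) ζ (γ.restrict (cube k)ᶜ)).restrict (cube k)).carrier = ∅ := by
    rw [glue_restrict_of_subset (cube_subset_cubes hk), restrict_restrict]
    rw [Set.eq_empty_iff_forall_notMem]
    exact fun u hu => hu.2.1 hu.2.2
  obtain ⟨D, hD, hle⟩ := h k _ γ hη
  have h1 := boltzmann_le_of_localEnergy_ge hU hβ (cube_subset_cubes hk) (isBounded_cubes K) ζ γ hD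
  refine (mul_le_mul_right h1 _).trans ?_
  simp only [← mul_assoc]
  refine mul_le_mul_left ?_ _
  rw [← ENNReal.ofReal_mul (Real.exp_nonneg _), ← ENNReal.ofReal_mul (Real.exp_nonneg _),
    ← ENNReal.ofReal_mul (by positivity), ← Real.exp_add, ← Real.exp_add, ← Real.exp_add]
  refine ENNReal.ofReal_le_ofReal (Real.exp_le_exp.2 ?_)
  linarith

/-! ### Integrated removal of the particles of one cube -/

lemma lintegral_oneParticle_le {U : Potentials d m} [SFinite U.spinMeasure] (Δ : Set (Pos d))
    (k : Fin d → ℤ) {φ : Pos m → ℝ≥0∞} (hφ : Measurable φ) :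
    ∫⁻ u in Prod.fst ⁻¹' cube k, φ u.2 ∂U.oneParticle Δ ≤ ∫⁻ s, φ s ∂U.spinMeasure := by
  have h : (U.oneParticle Δ).restrict (Prod.fst ⁻¹' cube k) =
      ((volume.restrict Δ).restrict (cube k)).prod U.spinMeasure := by
    rw [Potentials.oneParticle, ← Set.prod_univ, ← Measure.prod_restrict, Measure.restrict_univ]
  rw [h]
  calc ∫⁻ u, φ u.2 ∂((volume.restrict Δ).restrict (cube k)).prod U.spinMeasure
      = ∫⁻ u, 1 * φ u.2 ∂((volume.restrict Δ).restrict (cube k)).prod U.spinMeasure := by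
        simp only [one_mul]
    _ = (∫⁻ _x, 1 ∂(volume.restrict Δ).restrict (cube k)) * ∫⁻ s, φ s ∂U.spinMeasure :=
        lintegral_prod_mul (f := fun _ => 1) aemeasurable_const hφ.aemeasurable
    _ ≤ 1 * ∫⁻ s, φ s ∂U.spinMeasure := by
        gcongr
        rw [lintegral_one, Measure.restrict_apply_univ]
        exact (Measure.restrict_apply_le _ _).trans (volume_cube k).le
    _ = _ := one_mul _

lemma tupleMeasurable_lyapunov_glue (p q : ℕ) (K : Finset (Fin d → ℤ)) (ζ : MarkedConf d m)
    (j : Fin d → ℤ) :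
    TupleMeasurable fun γ : MarkedConf d m =>
      lyapunov p q ((glue (cubes K) ζ γ).restrict (cube j)) := by
  by_cases hj : j ∈ K
  · simp only [glue_restrict_of_subset (cube_subset_cubes hj)]
    exact tupleMeasurable_lyapunov p q (measurableSet_cube j) (isBounded_cube j)
  · simp only [glue_restrict_of_disjoint (disjoint_cube_cubes hj)]
    exact fun n => measurable_const

lemma measurable_ofReal_exp_mul (a : ℝ) :
    Measurable fun x : ℝ => ENNReal.ofReal (Real.exp (a * x)) := by fun_prop

lemma tupleMeasurable_exp_sum {ι : Type*} (s : Finset ι) {f : ι → MarkedConf d m → ℝ}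
    (hf : ∀ j ∈ s, TupleMeasurable (f j)) (a : ℝ) :
    TupleMeasurable fun γ => ENNReal.ofReal (Real.exp (a * ∑ j ∈ s, f j γ)) := fun n =>
  (measurable_ofReal_exp_mul a).comp (Finset.measurable_fun_sum s fun j hj => hf j hj n)

lemma one_lt_of_exponents {p q qV : ℕ} {r : ℝ} (hp : 2 < p) (hq : q < qV)
    (hpq : 1 ≤ ((p : ℝ) - 2) * ((q : ℝ) / r - 1)) : 1 < qV := by
  rcases Nat.eq_zero_or_pos q with rfl | h
  · have : (2 : ℝ) < p := by exact_mod_cast hp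
    simp only [Nat.cast_zero, zero_div] at hpq
    linarith
  · omega

lemma isFiniteMeasure_oneParticle {U : Potentials d m} {P r : ℝ} {qV : ℕ}
    (hU : U.Admissible P r qV) (hqV : 1 < qV) (K : Finset (Fin d → ℤ)) :
    IsFiniteMeasure (U.oneParticle (cubes K)) := by
  have := isFiniteMeasure_spinMeasure hU hqV
  have : IsFiniteMeasure ((volume : Measure (Pos d)).restrict (cubes K)) :=
    ⟨by rw [Measure.restrict_apply_univ]; exact (isBounded_cubes K).measure_lt_top⟩
  unfold Potentials.oneParticle
  infer_instance

/-- Removing the particles of the cube `k` costs a constant factor and an arbitrarily small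
multiple of `F` in the nearby cubes, uniformly in the volume and in the boundary condition. -/
theorem exists_lintegral_boltzmann_le {U : Potentials d m} {P r : ℝ} {qV : ℕ}
    (hU : U.Admissible P r qV) {p q : ℕ} (hp : 2 < p) (hpP : (p : ℝ) < P) (hq : q < qV)
    (hpq : 1 ≤ ((p : ℝ) - 2) * ((q : ℝ) / r - 1)) {z β : ℝ} (hz : 0 < z) (hβ : 0 < β) :
    ∃ M : ℕ, ∀ a ε : ℝ, 0 < ε → ∃ C : ℝ≥0, ∀ (K : Finset (Fin d → ℤ)), ∀ k ∈ K,
      ∀ (ζ : MarkedConf d m) (G : MarkedConf d m → ℝ≥0∞), TupleMeasurable G →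
      ∫⁻ γ, G (γ.restrict (cube k)ᶜ) *
          (ENNReal.ofReal (Real.exp (a * lyapunov p q (γ.restrict (cube k)))) *
            U.boltzmann β (cubes K) ζ γ) ∂U.lebesguePoisson z (cubes K) ≤
        C * ∫⁻ γ, {γ | (γ.restrict (cube k)).carrier = ∅}.indicator (fun γ => G γ *
          (ENNReal.ofReal (Real.exp (ε * ∑ j ∈ nearby M k,
            lyapunov p q ((glue (cubes K) ζ γ).restrict (cube j)))) *
          U.boltzmann β (cubes K) ζ γ)) γ ∂U.lebesguePoisson z (cubes K) := by
  classical
  have hqV := one_lt_of_exponents hp hq hpq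
  obtain ⟨M, hM⟩ := exists_boltzmann_le hU hp hpP hpq hβ
  refine ⟨M, fun a ε hε => ?_⟩
  obtain ⟨C, c, h⟩ := hM a ε hε
  have hfin := lintegral_exp_spinMeasure_lt_top hU hq hqV c
  have hser := poissonSeries_lt_top hz hfin.ne
  have := isFiniteMeasure_spinMeasure hU hqV
  refine ⟨(ENNReal.ofReal (Real.exp C) * poissonSeries z
    (∫⁻ s, ENNReal.ofReal (Real.exp (c * ‖s‖ ^ q)) ∂U.spinMeasure)).toNNReal,
    fun K k hk ζ G hG => ?_⟩
  rw [ENNReal.coe_toNNReal (ENNReal.mul_lt_top ENNReal.ofReal_lt_top hser).ne]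
  have := isFiniteMeasure_oneParticle hU hqV K
  have hexp : TupleMeasurable fun γ => ENNReal.ofReal (Real.exp (ε * ∑ j ∈ nearby M k,
      lyapunov p q ((glue (cubes K) ζ γ).restrict (cube j)))) :=
    tupleMeasurable_exp_sum _ (fun j _ => tupleMeasurable_lyapunov_glue p q K ζ j) ε
  have hb := tupleMeasurable_boltzmann hU β (measurableSet_cubes K) (isBounded_cubes K) ζ
  have hφ : Measurable fun u : Pos d × Pos m => ENNReal.ofReal (Real.exp (c * ‖u.2‖ ^ q)) := by
    fun_prop
  let G' : MarkedConf d m → ℝ≥0∞ := fun γ => G γ * (ENNReal.ofReal (Real.exp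
    (ε * ∑ j ∈ nearby M k, lyapunov p q ((glue (cubes K) ζ γ).restrict (cube j)))) *
      U.boltzmann β (cubes K) ζ γ)
  have hG' : TupleMeasurable G' := fun n => (hG n).mul ((hexp n).mul (hb n))
  have key := lintegral_prod_mul_restrict_compl_le U hz (cubes K) (measurableSet_cube k) hφ
    (fun γ => ENNReal.ofReal
        (Real.exp (c * ∑ᶠ u ∈ (γ.restrict (cube k)).carrier, ‖u.2‖ ^ q)) *
      G' (γ.restrict (cube k)ᶜ)) hG' (fun n w hw => by
      refine mul_le_mul_left (le_of_eq ?_) _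
      rw [finsum_mem_restrict_ofTuple hw, Finset.mul_sum, Real.exp_sum,
        ENNReal.ofReal_prod_of_nonneg fun i _ => Real.exp_nonneg _]
      refine Finset.prod_congr rfl fun i _ => ?_
      split_ifs <;> simp)
  rw [mul_assoc (ENNReal.ofReal (Real.exp C))]
  calc _ ≤ ∫⁻ γ, ENNReal.ofReal (Real.exp C) * (ENNReal.ofReal
        (Real.exp (c * ∑ᶠ u ∈ (γ.restrict (cube k)).carrier, ‖u.2‖ ^ q)) *
      G' (γ.restrict (cube k)ᶜ)) ∂U.lebesguePoisson z (cubes K) := by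
        refine lintegral_mono fun γ => ?_
        refine (mul_le_mul_right (h K k hk ζ γ) _).trans (le_of_eq ?_)
        ring
    _ = ENNReal.ofReal (Real.exp C) * _ := lintegral_const_mul' _ _ ENNReal.ofReal_ne_top
    _ ≤ _ := by
        refine mul_le_mul_right (key.trans (mul_le_mul_left ?_ _)) _
        exact poissonSeries_mono z (lintegral_oneParticle_le (cubes K) k
          (φ := fun s => ENNReal.ofReal (Real.exp (c * ‖s‖ ^ q))) (by fun_prop))

/-! ### Finiteness of the exponential moments in a finite volume -/

lemma boltzmann_of_restrict_eq_empty {U : Potentials d m} {β : ℝ} {Δ : Set (Pos d)}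
    {ζ γ : MarkedConf d m} (h : (γ.restrict Δ).carrier = ∅) : U.boltzmann β Δ ζ γ = 1 := by
  rw [Potentials.boltzmann, Potentials.condEnergy, condPosEnergy_eq, condSpinEnergy_eq, h]
  simp [pairSum, crossSum]

lemma restrict_carrier_eq_empty_of_subset {Δ Δ' : Set (Pos d)} (h : Δ' ⊆ Δ) {γ : MarkedConf d m}
    (hγ : (γ.restrict Δ).carrier = ∅) : (γ.restrict Δ').carrier = ∅ := by
  rw [Set.eq_empty_iff_forall_notMem] at hγ ⊢
  exact fun u hu => hγ u ⟨hu.1, h hu.2⟩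

lemma sum_lyapunov_glue_le (p q : ℕ) (K N : Finset (Fin d → ℤ)) (ζ γ : MarkedConf d m) :
    ∑ j ∈ N, lyapunov p q ((glue (cubes K) ζ γ).restrict (cube j)) ≤
      ∑ j ∈ K, lyapunov p q (γ.restrict (cube j)) +
        ∑ j ∈ N, lyapunov p q (ζ.restrict (cube j)) := by
  classical
  rw [← Finset.sum_filter_add_sum_filter_not N (fun j => j ∈ K)]
  refine add_le_add ?_ ?_
  · calc ∑ j ∈ N with j ∈ K, lyapunov p q ((glue (cubes K) ζ γ).restrict (cube j))
        = ∑ j ∈ N with j ∈ K, lyapunov p q (γ.restrict (cube j)) :=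
          Finset.sum_congr rfl fun j hj => by
            rw [glue_restrict_of_subset (cube_subset_cubes (Finset.mem_filter.1 hj).2)]
      _ ≤ _ := Finset.sum_le_sum_of_subset_of_nonneg
          (fun j hj => (Finset.mem_filter.1 hj).2) fun j _ _ => lyapunov_nonneg p q _
  · calc ∑ j ∈ N with j ∉ K, lyapunov p q ((glue (cubes K) ζ γ).restrict (cube j))
        = ∑ j ∈ N with j ∉ K, lyapunov p q (ζ.restrict (cube j)) :=
          Finset.sum_congr rfl fun j hj => by
            rw [glue_restrict_of_disjoint (disjoint_cube_cubes (Finset.mem_filter.1 hj).2)]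
      _ ≤ _ := Finset.sum_le_sum_of_subset_of_nonneg
          (Finset.filter_subset _ _) fun j _ _ => lyapunov_nonneg p q _

/-- All exponential moments are finite in a finite volume: the cubes are emptied one after the
other, each time at the cost of increasing the exponent. -/
theorem lintegral_exp_sum_lyapunov_lt_top {U : Potentials d m} {P r : ℝ} {qV : ℕ}
    (hU : U.Admissible P r qV) {p q : ℕ} (hp : 2 < p) (hpP : (p : ℝ) < P) (hq : q < qV)
    (hpq : 1 ≤ ((p : ℝ) - 2) * ((q : ℝ) / r - 1)) {z β : ℝ} (hz : 0 < z) (hβ : 0 < β)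
    (K : Finset (Fin d → ℤ)) (ζ : MarkedConf d m) {a : ℝ} (ha : 0 ≤ a) :
    ∫⁻ γ, ENNReal.ofReal (Real.exp (a * ∑ j ∈ K, lyapunov p q (γ.restrict (cube j)))) *
      U.boltzmann β (cubes K) ζ γ ∂U.lebesguePoisson z (cubes K) < ∞ := by
  classical
  have hqV := one_lt_of_exponents hp hq hpq
  have := isFiniteMeasure_oneParticle hU hqV K
  obtain ⟨M, hM⟩ := exists_lintegral_boltzmann_le hU hp hpP hq hpq hz hβ
  have hp0 : p ≠ 0 := by omega
  -- the configurations whose particles in the volume lie in the cubes indexed by `A`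
  have main : ∀ A : Finset (Fin d → ℤ), A ⊆ K → ∀ a : ℝ, 0 ≤ a →
      ∫⁻ γ, {γ | (γ.restrict (cubes (K \ A))).carrier = ∅}.indicator (fun γ =>
        ENNReal.ofReal (Real.exp (a * ∑ j ∈ K, lyapunov p q (γ.restrict (cube j)))) *
        U.boltzmann β (cubes K) ζ γ) γ ∂U.lebesguePoisson z (cubes K) < ∞ := by
    intro A
    induction A using Finset.induction_on with
    | empty =>
      intro _ a _
      refine lt_of_le_of_lt ?_ (lebesguePoisson_univ_lt_top U hz (cubes K))
      rw [← lintegral_one]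
      refine lintegral_mono fun γ => Set.indicator_apply_le' (fun hγ => ?_) fun _ => zero_le
      rw [Finset.sdiff_empty] at hγ
      have hγ' : (γ.restrict (cubes K)).carrier = ∅ := hγ
      have h0 : ∑ j ∈ K, lyapunov p q (γ.restrict (cube j)) = 0 :=
        Finset.sum_eq_zero fun j hj => lyapunov_of_carrier_eq_empty hp0 q
          (restrict_carrier_eq_empty_of_subset (cube_subset_cubes hj) hγ')
      rw [h0, boltzmann_of_restrict_eq_empty hγ']
      simp
    | insert k A hkA ih =>
      intro hAK a ha
      have hk : k ∈ K := hAK (Finset.mem_insert_self _ _)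
      obtain ⟨C, hC⟩ := hM a 1 one_pos
      set D := cubes (K \ insert k A) with hD
      have hDk : D ⊆ (cube k)ᶜ := by
        rw [Set.subset_compl_iff_disjoint_left]
        exact disjoint_cube_cubes (by simp)
      let G : MarkedConf d m → ℝ≥0∞ := {γ | (γ.restrict D).carrier = ∅}.indicator fun γ =>
        ENNReal.ofReal (Real.exp (a * ∑ j ∈ K.erase k, lyapunov p q (γ.restrict (cube j))))
      have hG : TupleMeasurable G := TupleMeasurable.indicator_restrict_eq_empty
        (tupleMeasurable_exp_sum _ (fun j _ => tupleMeasurable_lyapunov p q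
          (measurableSet_cube j) (isBounded_cube j)) a) (measurableSet_cubes _)
      set b := ∑ j ∈ nearby M k, lyapunov p q (ζ.restrict (cube j)) with hb
      have h1 : ∀ γ : MarkedConf d m, {γ | (γ.restrict D).carrier = ∅}.indicator (fun γ =>
          ENNReal.ofReal (Real.exp (a * ∑ j ∈ K, lyapunov p q (γ.restrict (cube j)))) *
            U.boltzmann β (cubes K) ζ γ) γ ≤
          G (γ.restrict (cube k)ᶜ) *
            (ENNReal.ofReal (Real.exp (a * lyapunov p q (γ.restrict (cube k)))) *
              U.boltzmann β (cubes K) ζ γ) := by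
        intro γ
        refine Set.indicator_apply_le' (fun hγ => ?_) fun _ => zero_le
        have hγD : γ.restrict (cube k)ᶜ ∈
            {γ : MarkedConf d m | (γ.restrict D).carrier = ∅} := by
          show ((γ.restrict (cube k)ᶜ).restrict D).carrier = ∅
          rw [restrict_restrict, Set.inter_eq_right.2 hDk]
          exact hγ
        have hsum : ∑ j ∈ K.erase k, lyapunov p q ((γ.restrict (cube k)ᶜ).restrict (cube j)) =
            ∑ j ∈ K.erase k, lyapunov p q (γ.restrict (cube j)) := by
          refine Finset.sum_congr rfl fun j hj => ?_
          have : cube j ⊆ (cube k)ᶜ := by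
            rw [Set.subset_compl_iff_disjoint_right]
            exact disjoint_cube (Finset.ne_of_mem_erase hj)
          rw [restrict_restrict, Set.inter_eq_right.2 this]
        simp only [G]
        rw [Set.indicator_of_mem hγD, hsum, ← mul_assoc, ← ENNReal.ofReal_mul (Real.exp_nonneg _),
          ← Real.exp_add, ← mul_add, Finset.sum_erase_add _ _ hk]
      have h2 : ∀ γ : MarkedConf d m,
          {γ | (γ.restrict (cube k)).carrier = ∅}.indicator (fun γ => G γ *
            (ENNReal.ofReal (Real.exp (1 * ∑ j ∈ nearby M k,
              lyapunov p q ((glue (cubes K) ζ γ).restrict (cube j)))) *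
            U.boltzmann β (cubes K) ζ γ)) γ ≤
          ENNReal.ofReal (Real.exp b) *
            {γ | (γ.restrict (cubes (K \ A))).carrier = ∅}.indicator (fun γ =>
              ENNReal.ofReal (Real.exp ((a + 1) *
                ∑ j ∈ K, lyapunov p q (γ.restrict (cube j)))) *
              U.boltzmann β (cubes K) ζ γ) γ := by
        intro γ
        refine Set.indicator_apply_le' (fun hγ => ?_) fun _ => zero_le
        by_cases hγD : γ ∈ {γ : MarkedConf d m | (γ.restrict D).carrier = ∅}
        · have hmem : γ ∈ {γ : MarkedConf d m | (γ.restrict (cubes (K \ A))).carrier = ∅} := by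
            show (γ.restrict (cubes (K \ A))).carrier = ∅
            have e1 : (γ.restrict (cube k)).carrier = ∅ := hγ
            have e2 : (γ.restrict D).carrier = ∅ := hγD
            rw [Set.eq_empty_iff_forall_notMem] at e1 e2 ⊢
            rintro u ⟨hu, hu'⟩
            rw [mem_cubes_iff, Finset.mem_sdiff] at hu'
            by_cases huk : cubeIndex u.1 = k
            · exact e1 u ⟨hu, mem_cube_iff.2 huk⟩
            · refine e2 u ⟨hu, ?_⟩
              rw [hD, mem_cubes_iff, Finset.mem_sdiff, Finset.mem_insert]
              tauto
          simp only [G]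
          rw [Set.indicator_of_mem hmem, Set.indicator_of_mem hγD]
          simp only [← mul_assoc]
          refine mul_le_mul_left ?_ _
          rw [← ENNReal.ofReal_mul (Real.exp_nonneg _), ← ENNReal.ofReal_mul (Real.exp_nonneg _),
            ← Real.exp_add, ← Real.exp_add]
          refine ENNReal.ofReal_le_ofReal (Real.exp_le_exp.2 ?_)
          have e1 := sum_lyapunov_glue_le p q K (nearby M k) ζ γ
          have e2 : a * ∑ j ∈ K.erase k, lyapunov p q (γ.restrict (cube j)) ≤
              a * ∑ j ∈ K, lyapunov p q (γ.restrict (cube j)) :=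
            mul_le_mul_of_nonneg_left (Finset.sum_le_sum_of_subset_of_nonneg
              (Finset.erase_subset _ _) fun j _ _ => lyapunov_nonneg p q _) ha
          linarith
        · simp only [G]
          rw [Set.indicator_of_notMem hγD, zero_mul]
          exact zero_le
      refine (lintegral_mono h1).trans_lt ((hC K k hk ζ G hG).trans_lt ?_)
      refine ENNReal.mul_lt_top ENNReal.coe_lt_top ((lintegral_mono h2).trans_lt ?_)
      rw [lintegral_const_mul' _ _ ENNReal.ofReal_ne_top]
      exact ENNReal.mul_lt_top ENNReal.ofReal_lt_top
        (ih (fun j hj => hAK (Finset.mem_insert_of_mem hj)) (a + 1) (by linarith))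
  have h := main K subset_rfl a ha
  have huniv : {γ : MarkedConf d m | (γ.restrict (cubes (K \ K))).carrier = ∅} = Set.univ := by
    rw [Set.eq_univ_iff_forall]
    intro γ
    show (γ.restrict (cubes (K \ K))).carrier = ∅
    simp [Set.eq_empty_iff_forall_notMem, mem_cubes_iff]
  rwa [huniv, Set.indicator_univ] at h

/-! ### The local Gibbs state -/

lemma lintegral_localGibbs (U : Potentials d m) {z β : ℝ} {Δ : Set (Pos d)} {ζ : MarkedConf d m}
    (hb : TupleMeasurable fun γ => U.boltzmann β Δ ζ γ) {f : MarkedConf d m → ℝ≥0∞}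
    (hf : TupleMeasurable f) :
    ∫⁻ γ, f γ ∂U.localGibbs z β Δ ζ = (U.partition z β Δ ζ)⁻¹ *
      ∫⁻ γ, f γ * U.boltzmann β Δ ζ γ ∂U.lebesguePoisson z Δ := by
  rw [Potentials.localGibbs, lintegral_smul_measure, smul_eq_mul,
    lintegral_withDensity_eq_lintegral_mul₀ (hb.aemeasurable U z Δ) (hf.aemeasurable U z Δ)]
  simp only [Pi.mul_apply, mul_comm]

/-- The empty configuration contributes `1` to the partition function. -/
lemma one_le_partition {U : Potentials d m} {z β : ℝ} {Δ : Set (Pos d)}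
    [IsFiniteMeasure (U.oneParticle Δ)] {ζ : MarkedConf d m}
    (hb : TupleMeasurable fun γ => U.boltzmann β Δ ζ γ) :
    1 ≤ U.partition z β Δ ζ := by
  rw [Potentials.partition, lintegral_lebesguePoisson U z Δ hb]
  refine le_trans (le_of_eq ?_) (ENNReal.le_tsum 0)
  have hs : simpleTuples d m 0 = Set.univ :=
    Set.eq_univ_of_forall fun w => Function.injective_of_subsingleton _
  have h1 : ∀ w : Fin 0 → Pos d × Pos m, U.boltzmann β Δ ζ (ofTuple w) = 1 := fun w =>
    boltzmann_of_restrict_eq_empty ((restrict_ofTuple_eq_empty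
      (Function.injective_of_subsingleton _)).2 fun i => i.elim0)
  rw [hs, Measure.restrict_univ, lintegral_congr h1, lintegral_one, Measure.pi_univ]
  simp [poissonCoeff]

lemma localGibbs_univ {U : Potentials d m} {z β : ℝ} {Δ : Set (Pos d)}
    [IsFiniteMeasure (U.oneParticle Δ)] {ζ : MarkedConf d m}
    (hb : TupleMeasurable fun γ => U.boltzmann β Δ ζ γ) (hfin : U.partition z β Δ ζ ≠ ∞) :
    U.localGibbs z β Δ ζ Set.univ = 1 := by
  rw [← lintegral_one, lintegral_localGibbs U hb fun n => measurable_const]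
  simp only [one_mul]
  exact ENNReal.inv_mul_cancel (one_pos.trans_le (one_le_partition hb)).ne' hfin

/-- The exponential moment of `F` in the cube `j` under the specification kernel. -/
noncomputable def expMoment (U : Potentials d m) (z β : ℝ) (p q : ℕ) (a : ℝ)
    (K : Finset (Fin d → ℤ)) (ζ : MarkedConf d m) (j : Fin d → ℤ) : ℝ≥0∞ :=
  ∫⁻ γ, ENNReal.ofReal (Real.exp (a * lyapunov p q ((glue (cubes K) ζ γ).restrict (cube j))))
    ∂U.localGibbs z β (cubes K) ζ

lemma tupleMeasurable_exp_lyapunov_glue (p q : ℕ) (a : ℝ) (K : Finset (Fin d → ℤ))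
    (ζ : MarkedConf d m) (j : Fin d → ℤ) :
    TupleMeasurable fun γ : MarkedConf d m => ENNReal.ofReal (Real.exp
      (a * lyapunov p q ((glue (cubes K) ζ γ).restrict (cube j)))) :=
  (tupleMeasurable_lyapunov_glue p q K ζ j).comp (measurable_ofReal_exp_mul a)

/-- The exponential of a sum is dominated by the exponentials of its rescaled terms. -/
lemma exp_mul_sum_le {ι : Type*} (s : Finset ι) {x : ι → ℝ} (hs : s.Nonempty)
    {a : ℝ} (ha : 0 ≤ a) :
    ENNReal.ofReal (Real.exp (a / s.card * ∑ j ∈ s, x j)) ≤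
      ∑ j ∈ s, ENNReal.ofReal (Real.exp (a * x j)) := by
  obtain ⟨i, hi, hmax⟩ := s.exists_max_image x hs
  refine le_trans (ENNReal.ofReal_le_ofReal (Real.exp_le_exp.2 ?_))
    (Finset.single_le_sum (f := fun j => ENNReal.ofReal (Real.exp (a * x j)))
      (fun _ _ => zero_le) hi)
  have hc : (0 : ℝ) < s.card := by exact_mod_cast hs.card_pos
  have h1 : ∑ j ∈ s, x j ≤ s.card * x i := by
    rw [← nsmul_eq_mul]; exact Finset.sum_le_card_nsmul _ _ _ hmax
  calc a / s.card * ∑ j ∈ s, x j ≤ a / s.card * (s.card * x i) := by gcongr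
    _ = a * x i := by field_simp

/-- Jensen's inequality for the square root. -/
lemma lintegral_rpow_half_le {X : Type*} [MeasurableSpace X] {μ : Measure X} (hμ : μ Set.univ = 1)
    {f : X → ℝ≥0∞} (hf : AEMeasurable f μ) :
    ∫⁻ x, f x ^ (1 / 2 : ℝ) ∂μ ≤ (∫⁻ x, f x ∂μ) ^ (1 / 2 : ℝ) := by
  have h := ENNReal.lintegral_mul_norm_pow_le (g := fun _ => (1 : ℝ≥0∞)) hf aemeasurable_const
    (p := 1 / 2) (q := 1 / 2) (by norm_num) (by norm_num) (by norm_num)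
  simpa [hμ] using h

/-- The basic recursion for exponential moments: the moment in a cube is controlled by the square
roots of the moments in the nearby cubes. -/
theorem exists_expMoment_le {U : Potentials d m} {P r : ℝ} {qV : ℕ}
    (hU : U.Admissible P r qV) {p q : ℕ} (hp : 2 < p) (hpP : (p : ℝ) < P) (hq : q < qV)
    (hpq : 1 ≤ ((p : ℝ) - 2) * ((q : ℝ) / r - 1)) {z β : ℝ} (hz : 0 < z) (hβ : 0 < β) :
    ∃ M : ℕ, ∀ a : ℝ, 0 < a → ∃ C : ℝ≥0, ∀ (K : Finset (Fin d → ℤ)) (ζ : MarkedConf d m),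
      U.localGibbs z β (cubes K) ζ Set.univ = 1 ∧
      (∀ j ∉ K, expMoment U z β p q a K ζ j =
        ENNReal.ofReal (Real.exp (a * lyapunov p q (ζ.restrict (cube j))))) ∧
      (∀ j ∈ K, expMoment U z β p q a K ζ j < ∞) ∧
      ∀ k ∈ K, expMoment U z β p q a K ζ k ≤
        C * ∑ j ∈ nearby M k, expMoment U z β p q a K ζ j ^ (1 / 2 : ℝ) := by
  obtain ⟨M, hM⟩ := exists_lintegral_boltzmann_le hU hp hpP hq hpq hz hβ
  refine ⟨M, fun a ha => ?_⟩
  set L : ℝ := (((2 * M + 1) ^ d : ℕ) : ℝ) with hL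
  have hL0 : 0 < L := by positivity
  obtain ⟨C, hC⟩ := hM a (a / 2 / L) (by positivity)
  refine ⟨C, fun K ζ => ?_⟩
  have hb := tupleMeasurable_boltzmann hU β (measurableSet_cubes K) (isBounded_cubes K) ζ
  have := isFiniteMeasure_oneParticle hU (one_lt_of_exponents hp hq hpq) K
  have hZ : U.partition z β (cubes K) ζ ≠ ∞ := by
    have := lintegral_exp_sum_lyapunov_lt_top hU hp hpP hq hpq hz hβ K ζ le_rfl
    simp only [zero_mul, Real.exp_zero, ENNReal.ofReal_one, one_mul] at this
    exact this.ne
  have hZ0 : U.partition z β (cubes K) ζ ≠ 0 := (one_pos.trans_le (one_le_partition hb)).ne'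
  have hμ := localGibbs_univ hb hZ
  have hX := tupleMeasurable_exp_lyapunov_glue p q a K ζ
  refine ⟨hμ, fun j hj => ?_, fun j hj => ?_, fun k hk => ?_⟩
  · simp only [expMoment, glue_restrict_of_disjoint (disjoint_cube_cubes hj)]
    rw [lintegral_const, hμ, mul_one]
  · rw [expMoment, lintegral_localGibbs U hb (hX j)]
    refine ENNReal.mul_lt_top (ENNReal.inv_lt_top.2 (pos_iff_ne_zero.2 hZ0)) ?_
    refine lt_of_le_of_lt ?_ (lintegral_exp_sum_lyapunov_lt_top hU hp hpP hq hpq hz hβ K ζ ha.le)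
    refine lintegral_mono fun γ => mul_le_mul_left (ENNReal.ofReal_le_ofReal ?_) _
    rw [glue_restrict_of_subset (cube_subset_cubes hj)]
    gcongr
    exact Finset.single_le_sum (f := fun j => lyapunov p q (γ.restrict (cube j)))
      (fun _ _ => lyapunov_nonneg p q _) hj
  · have hS : TupleMeasurable fun γ => ENNReal.ofReal (Real.exp (a / 2 / L * ∑ j ∈ nearby M k,
        lyapunov p q ((glue (cubes K) ζ γ).restrict (cube j)))) :=
      tupleMeasurable_exp_sum _ (fun j _ => tupleMeasurable_lyapunov_glue p q K ζ j) _
    have h1 := hC K k hk ζ (fun _ => 1) (fun n => measurable_const)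
    simp only [one_mul] at h1
    have h2 : expMoment U z β p q a K ζ k ≤ C * ∫⁻ γ, ENNReal.ofReal (Real.exp
        (a / 2 / L * ∑ j ∈ nearby M k, lyapunov p q ((glue (cubes K) ζ γ).restrict (cube j))))
          ∂U.localGibbs z β (cubes K) ζ := by
      rw [expMoment, lintegral_localGibbs U hb (hX k), lintegral_localGibbs U hb hS,
        mul_left_comm]
      refine mul_le_mul_right ?_ _
      simp only [glue_restrict_of_subset (cube_subset_cubes hk)]
      refine h1.trans (mul_le_mul_right (lintegral_mono fun γ => ?_) _)
      exact Set.indicator_le_self _ _ γ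
    refine h2.trans (mul_le_mul_right ?_ _)
    calc ∫⁻ γ, ENNReal.ofReal (Real.exp (a / 2 / L * ∑ j ∈ nearby M k,
          lyapunov p q ((glue (cubes K) ζ γ).restrict (cube j)))) ∂U.localGibbs z β (cubes K) ζ
        ≤ ∫⁻ γ, ∑ j ∈ nearby M k, ENNReal.ofReal (Real.exp (a / 2 *
            lyapunov p q ((glue (cubes K) ζ γ).restrict (cube j))))
            ∂U.localGibbs z β (cubes K) ζ := by
          refine lintegral_mono fun γ => ?_
          have := exp_mul_sum_le (nearby M k)
            (x := fun j => lyapunov p q ((glue (cubes K) ζ γ).restrict (cube j)))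
            ⟨k, self_mem_nearby M k⟩ (half_pos ha).le
          rwa [card_nearby] at this
      _ = ∑ j ∈ nearby M k, ∫⁻ γ, ENNReal.ofReal (Real.exp (a / 2 *
            lyapunov p q ((glue (cubes K) ζ γ).restrict (cube j))))
            ∂U.localGibbs z β (cubes K) ζ := by
          refine lintegral_finsetSum' _ fun j _ => ?_
          refine AEMeasurable.smul_measure ?_ _
          exact ((tupleMeasurable_exp_lyapunov_glue p q (a / 2) K ζ j).aemeasurable U z
            (cubes K)).mono_ac (withDensity_absolutelyContinuous _ _)
      _ ≤ _ := by
          refine Finset.sum_le_sum fun j _ => ?_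
          have h3 : ∀ γ : MarkedConf d m, ENNReal.ofReal (Real.exp (a / 2 *
              lyapunov p q ((glue (cubes K) ζ γ).restrict (cube j)))) =
              ENNReal.ofReal (Real.exp (a *
                lyapunov p q ((glue (cubes K) ζ γ).restrict (cube j)))) ^ (1 / 2 : ℝ) := by
            intro γ
            rw [ENNReal.ofReal_rpow_of_pos (Real.exp_pos _), ← Real.exp_mul]
            congr 2
            ring
          simp only [h3]
          refine lintegral_rpow_half_le hμ (AEMeasurable.smul_measure ?_ _)
          exact ((hX j).aemeasurable U z (cubes K)).mono_ac (withDensity_absolutelyContinuous _ _)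

/-! ### Solving the recursion -/

/-- A recursive inequality on a finite subset of the lattice, solved with exponential weights. -/
lemma le_max_of_recursion {K : Finset (Fin d → ℤ)} {x : (Fin d → ℤ) → ℝ} {M : ℕ} {c b α : ℝ}
    (hx : ∀ j, 0 ≤ x j) (hc : 0 ≤ c) (hα : 0 ≤ α)
    (hαM : Real.exp (α * (√d * M)) ≤ 3 / 2)
    (hrec : ∀ k ∈ K, ∃ j ∈ nearby M k, x k ≤ c + 1 / 2 * x j) {k₀ : Fin d → ℤ} (hk₀ : k₀ ∈ K)
    (hb : ∀ j ∉ K, x j * Real.exp (-α * ‖latticePoint j - latticePoint k₀‖) ≤ b) :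
    x k₀ ≤ max (4 * c) b := by
  let φ : (Fin d → ℤ) → ℝ := fun j =>
    x j * Real.exp (-α * ‖latticePoint j - latticePoint k₀‖)
  have hφ0 : φ k₀ = x k₀ := by simp [φ]
  have hstep : ∀ k ∈ K, ∃ j, φ k ≤ c + 3 / 4 * φ j := by
    intro k hk
    obtain ⟨j, hj, hkj⟩ := hrec k hk
    refine ⟨j, ?_⟩
    have h1 : Real.exp (-α * ‖latticePoint k - latticePoint k₀‖) ≤ 1 := by
      rw [Real.exp_le_one_iff]
      have := mul_nonneg hα (norm_nonneg (latticePoint k - latticePoint k₀))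
      linarith
    have h2 : Real.exp (-α * ‖latticePoint k - latticePoint k₀‖) ≤
        3 / 2 * Real.exp (-α * ‖latticePoint j - latticePoint k₀‖) := by
      refine le_trans ?_ (mul_le_mul_of_nonneg_right hαM (Real.exp_nonneg _))
      rw [← Real.exp_add]
      refine Real.exp_le_exp.2 ?_
      have h3 : ‖latticePoint j - latticePoint k₀‖ ≤
          ‖latticePoint j - latticePoint k‖ + ‖latticePoint k - latticePoint k₀‖ :=
        norm_sub_le_norm_sub_add_norm_sub _ _ _
      have h4 := norm_latticePoint_sub_le hj
      have h5 : α * ‖latticePoint j - latticePoint k₀‖ ≤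
          α * (√d * M + ‖latticePoint k - latticePoint k₀‖) := by gcongr; linarith
      linarith
    calc φ k ≤ (c + 1 / 2 * x j) * Real.exp (-α * ‖latticePoint k - latticePoint k₀‖) := by
          simp only [φ]; gcongr
      _ = c * Real.exp (-α * ‖latticePoint k - latticePoint k₀‖) +
          1 / 2 * x j * Real.exp (-α * ‖latticePoint k - latticePoint k₀‖) := by ring
      _ ≤ c * 1 + 1 / 2 * x j *
          (3 / 2 * Real.exp (-α * ‖latticePoint j - latticePoint k₀‖)) := by
          have := hx j
          gcongr
      _ = c + 3 / 4 * φ j := by simp only [φ]; ring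
  obtain ⟨k, hk, hmax⟩ := K.exists_max_image φ ⟨k₀, hk₀⟩
  have hle : x k₀ ≤ φ k := hφ0 ▸ hmax k₀ hk₀
  obtain ⟨j, hj⟩ := hstep k hk
  by_cases hjK : j ∈ K
  · have := hmax j hjK
    exact le_max_of_le_left (by linarith)
  · have h1 : φ j ≤ b := hb j hjK
    have h2 := le_max_left (4 * c) b
    have h3 := le_max_right (4 * c) b
    linarith

/-- A tempered configuration is negligible far away with respect to exponential weights. -/
lemma exists_finset_lyapunov_le {p q : ℕ} {ζ : MarkedConf d m} (hζ : ζ ∈ tempered d m p q)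
    {a α : ℝ} (ha : 0 ≤ a) (hα : 0 < α) (k₀ : Fin d → ℤ) :
    ∃ T : Finset (Fin d → ℤ), ∀ j ∉ T, a * lyapunov p q (ζ.restrict (cube j)) *
      Real.exp (-α * ‖latticePoint j - latticePoint k₀‖) ≤ 1 := by
  have hfin := hζ (α / 2) (half_pos hα)
  set S := weightedSup p q (α / 2) ζ with hS
  have hle : ∀ j, Real.exp (-(α / 2) * ‖latticePoint j‖) * lyapunov p q (ζ.restrict (cube j)) ≤
      S.toReal := by
    intro j
    rw [← ENNReal.ofReal_le_iff_le_toReal hfin.ne]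
    exact le_iSup (fun k : Fin d → ℤ => ENNReal.ofReal (Real.exp (-(α / 2) * ‖latticePoint k‖) *
      lyapunov p q (ζ.restrict (cube k)))) j
  set D := a * S.toReal * Real.exp (α * ‖latticePoint k₀‖) with hD
  have hD0 : 0 ≤ D := by positivity
  refine ⟨(finite_latticePoint_norm_le (d := d) (2 / α * D)).toFinset, fun j hj => ?_⟩
  rw [Set.Finite.mem_toFinset, Set.mem_ofPred_eq, not_le] at hj
  have h1 : D ≤ Real.exp (α / 2 * ‖latticePoint j‖) := by
    have h2 : D ≤ α / 2 * ‖latticePoint j‖ := by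
      have := mul_le_mul_of_nonneg_left hj.le (half_pos hα).le
      have h3 : α / 2 * (2 / α * D) = D := by field_simp
      linarith
    have := Real.add_one_le_exp (α / 2 * ‖latticePoint j‖)
    linarith
  have h4 : Real.exp (-α * ‖latticePoint j - latticePoint k₀‖) ≤
      Real.exp (α * ‖latticePoint k₀‖) * (Real.exp (-(α / 2) * ‖latticePoint j‖) *
        Real.exp (-(α / 2) * ‖latticePoint j‖)) := by
    rw [← Real.exp_add, ← Real.exp_add]
    refine Real.exp_le_exp.2 ?_
    have h5 : α * ‖latticePoint j‖ ≤
        α * (‖latticePoint j - latticePoint k₀‖ + ‖latticePoint k₀‖) := by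
      gcongr
      have := norm_add_le (latticePoint j - latticePoint k₀) (latticePoint k₀)
      rwa [sub_add_cancel] at this
    linarith
  have hF := lyapunov_nonneg p q (ζ.restrict (cube j))
  calc a * lyapunov p q (ζ.restrict (cube j)) *
        Real.exp (-α * ‖latticePoint j - latticePoint k₀‖)
      ≤ a * lyapunov p q (ζ.restrict (cube j)) * (Real.exp (α * ‖latticePoint k₀‖) *
          (Real.exp (-(α / 2) * ‖latticePoint j‖) *
            Real.exp (-(α / 2) * ‖latticePoint j‖))) := by gcongr
    _ = a * (Real.exp (-(α / 2) * ‖latticePoint j‖) * lyapunov p q (ζ.restrict (cube j))) *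
          Real.exp (α * ‖latticePoint k₀‖) * Real.exp (-(α / 2) * ‖latticePoint j‖) := by ring
    _ ≤ a * S.toReal * Real.exp (α * ‖latticePoint k₀‖) *
          Real.exp (-(α / 2) * ‖latticePoint j‖) := by
        gcongr
        exact hle j
    _ ≤ Real.exp (α / 2 * ‖latticePoint j‖) * Real.exp (-(α / 2) * ‖latticePoint j‖) := by
        gcongr
    _ = 1 := by rw [← Real.exp_add]; simp

/-- In large volumes the exponential moments are bounded by a constant that depends neither on the
cube nor on the tempered boundary condition. -/
theorem exists_eventually_expMoment_le {U : Potentials d m} {P r : ℝ} {qV : ℕ}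
    (hU : U.Admissible P r qV) {p q : ℕ} (hp : 2 < p) (hpP : (p : ℝ) < P) (hq : q < qV)
    (hpq : 1 ≤ ((p : ℝ) - 2) * ((q : ℝ) / r - 1)) {z β : ℝ} (hz : 0 < z) (hβ : 0 < β)
    {a : ℝ} (ha : 0 < a) :
    ∃ Ψ : ℝ≥0, ∀ ζ ∈ tempered d m p q, ∀ k : Fin d → ℤ,
      ∀ᶠ K : Finset (Fin d → ℤ) in atTop, k ∈ K ∧ expMoment U z β p q a K ζ k ≤ Ψ := by
  classical
  obtain ⟨M, hM⟩ := exists_expMoment_le (d := d) (m := m) hU hp hpP hq hpq hz hβ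
  obtain ⟨C, hC⟩ := hM a ha
  set L : ℝ := (((2 * M + 1) ^ d : ℕ) : ℝ) with hL
  set D : ℝ := max 1 (C * L) with hD
  have hD1 : 1 ≤ D := le_max_left _ _
  set c := Real.log D with hc
  have hc0 : 0 ≤ c := Real.log_nonneg hD1
  set α := Real.log (3 / 2) / (√d * M + 1) with hα
  have hα0 : 0 < α := div_pos (Real.log_pos (by norm_num)) (by positivity)
  have hαM : Real.exp (α * (√d * M)) ≤ 3 / 2 := by
    rw [← Real.le_log_iff_exp_le (by norm_num), hα, div_mul_eq_mul_div,
      div_le_iff₀ (by positivity)]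
    have := Real.log_pos (show (1 : ℝ) < 3 / 2 by norm_num)
    nlinarith
  refine ⟨(Real.exp (max (4 * c) 1)).toNNReal, fun ζ hζ k₀ => ?_⟩
  obtain ⟨T, hT⟩ := exists_finset_lyapunov_le hζ ha.le hα0 k₀
  filter_upwards [eventually_ge_atTop (insert k₀ T)] with K hK
  have hk₀ : k₀ ∈ K := hK (Finset.mem_insert_self _ _)
  refine ⟨hk₀, ?_⟩
  obtain ⟨hμ, hout, hin, hrec⟩ := hC K ζ
  set E := expMoment U z β p q a K ζ with hE
  have hEfin : ∀ j, E j ≠ ∞ := fun j => by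
    by_cases hj : j ∈ K
    · exact (hin j hj).ne
    · rw [hout j hj]; exact ENNReal.ofReal_ne_top
  have hE1 : ∀ j, 1 ≤ (E j).toReal := fun j => by
    rw [← ENNReal.ofReal_le_iff_le_toReal (hEfin j), ENNReal.ofReal_one, ← hμ, ← lintegral_one]
    refine lintegral_mono fun γ => ?_
    rw [← ENNReal.ofReal_one]
    refine ENNReal.ofReal_le_ofReal (Real.one_le_exp ?_)
    exact mul_nonneg ha.le (lyapunov_nonneg p q _)
  have hkey := le_max_of_recursion (K := K) (x := fun j => Real.log (E j).toReal) (M := M)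
    (c := c) (b := 1) (α := α) (fun j => Real.log_nonneg (hE1 j)) hc0 hα0.le hαM ?_ hk₀ ?_
  · rw [Real.log_le_iff_le_exp (by linarith [hE1 k₀])] at hkey
    rw [← ENNReal.ofReal_toReal (hEfin k₀)]
    exact ENNReal.ofReal_le_ofReal hkey
  · intro k hk
    -- the largest of the moments in the nearby cubes
    obtain ⟨j, hj, hmax⟩ := (nearby M k).exists_max_image (fun j => (E j).toReal)
      ⟨k, self_mem_nearby M k⟩
    refine ⟨j, hj, ?_⟩
    have h1 : (E k).toReal ≤ D * (E j).toReal ^ (1 / 2 : ℝ) := by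
      have h2 : E k ≤ ENNReal.ofReal (C * (L * (E j).toReal ^ (1 / 2 : ℝ))) := by
        refine (hrec k hk).trans ?_
        rw [ENNReal.ofReal_mul (NNReal.coe_nonneg C), ENNReal.ofReal_coe_nnreal]
        refine mul_le_mul_right ?_ _
        calc ∑ i ∈ nearby M k, E i ^ (1 / 2 : ℝ)
            ≤ ∑ _i ∈ nearby M k, ENNReal.ofReal ((E j).toReal ^ (1 / 2 : ℝ)) := by
              refine Finset.sum_le_sum fun i hi => ?_
              rw [← ENNReal.ofReal_rpow_of_nonneg ENNReal.toReal_nonneg (by norm_num)]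
              refine ENNReal.rpow_le_rpow ?_ (by norm_num)
              rw [ENNReal.le_ofReal_iff_toReal_le (hEfin i) ENNReal.toReal_nonneg]
              exact hmax i hi
          _ = _ := by
              rw [Finset.sum_const, card_nearby, nsmul_eq_mul, hL,
                ENNReal.ofReal_mul (Nat.cast_nonneg _), ENNReal.ofReal_natCast]
      have h3 : (E k).toReal ≤ C * (L * (E j).toReal ^ (1 / 2 : ℝ)) := by
        have := ENNReal.toReal_mono ENNReal.ofReal_ne_top h2
        rwa [ENNReal.toReal_ofReal (by positivity)] at this
      have h4 : C * L * (E j).toReal ^ (1 / 2 : ℝ) ≤ D * (E j).toReal ^ (1 / 2 : ℝ) := by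
        gcongr
        exact le_max_right _ _
      linarith
    have hj0 : 0 < (E j).toReal := by linarith [hE1 j]
    calc Real.log (E k).toReal ≤ Real.log (D * (E j).toReal ^ (1 / 2 : ℝ)) :=
          Real.log_le_log (by linarith [hE1 k]) h1
      _ = c + 1 / 2 * Real.log (E j).toReal := by
          rw [Real.log_mul (by linarith) (by positivity), Real.log_rpow hj0]
  · intro j hj
    have hjT : j ∉ T := fun h => hj (hK (Finset.mem_insert_of_mem h))
    have h1 : Real.log (E j).toReal = a * lyapunov p q (ζ.restrict (cube j)) := by
      rw [hout j hj, ENNReal.toReal_ofReal (Real.exp_nonneg _), Real.log_exp]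
    simp only [h1]
    exact hT j hjT

end MarkedGibbs

theorem theorem3p1 {d m : ℕ} (U : MarkedGibbs.Potentials d m) (P r : ℝ) (qV : ℕ)
    (hU : U.Admissible P r qV)
    (p q : ℕ) (hp : 2 < p) (hpP : (p : ℝ) < P) (hq : q < qV)
    (hpq : 1 ≤ ((p : ℝ) - 2) * ((q : ℝ) / r - 1))
    (z β : ℝ) (hz : 0 < z) (hβ : 0 < β) (a : ℝ) :
    ∃ Ψ : ℝ≥0, ∀ ζ ∈ MarkedGibbs.MarkedConf.tempered d m p q, ∀ k : Fin d → ℤ,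
      limsup (fun K : Finset (Fin d → ℤ) =>
        ∫⁻ γ, ENNReal.ofReal
            (Real.exp (a * MarkedGibbs.MarkedConf.lyapunov p q (γ.restrict (MarkedGibbs.cube k))))
          ∂(U.specification z β (MarkedGibbs.cubes K) ζ)) atTop ≤ (Ψ : ℝ≥0∞) := by
  obtain ⟨Ψ, hΨ⟩ := MarkedGibbs.exists_eventually_expMoment_le hU hp hpP hq hpq hz hβ
    (show 0 < |a| + 1 by positivity)
  refine ⟨Ψ, fun ζ hζ k => limsup_le_of_le (by isBoundedDefault) ?_⟩
  filter_upwards [hΨ ζ hζ k] with K hK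
  refine (lintegral_map_le _ _).trans (le_trans (lintegral_mono fun γ => ?_) hK.2)
  refine ENNReal.ofReal_le_ofReal (Real.exp_le_exp.2 ?_)
  refine mul_le_mul_of_nonneg_right ?_ (MarkedGibbs.MarkedConf.lyapunov_nonneg p q _)
  have := le_abs_self a
  linarith
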